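/- Theorem 4.3. Conventions. All graphs are finite and simple; a weighted graph $G_w$ is a graph $G$ together with a positive real weight $w(e)$ on each edge $e$. Its adjacency matrix has the entry $w(v_iv_j)$ at $(i,j)$ if $v_iv_j$ is an edge and $0$ otherwise, and $i_+(G_w)$ is the number of positive eigenvalues of this matrix, counted with multiplicity. A graph is bicyclic if it is connected and has exactly one more edge than vertices. A pendant vertex is a vertex of degree $1$. For $p,q\ge 3$ and $l\ge 1$, $\infty(p,l,q)$ is obtained from two disjoint cycles $C^p$, $C^q$ and a path $v_1v_2\cdots v_l$ by identifying a vertex of $C^p$ with $v_1$ and a vertex of $C^q$ with $v_l$. In $\infty(p,l,q)_w$ the weights of the edges of $C^p$, in cyclic order starting and ending at $v_1$, are $a_1,\dots,a_p$; those of $C^q$, in cyclic order starting and ending at $v_l$, are $b_1,\dots,b_q$; and $w(v_jv_{j+1})=c_j$ for $1\le j\le l-1$. For $p,l,q\ge 0$, at most one of them $0$, $\theta(p,l,q)$ is obtained from three paths on $p+2$, $l+2$ and $q+2$ vertices by identifying their three initial vertices and identifying their three terminal vertices. In $\theta(p,l,q)_w$ the weights along the three paths, from the initial to the terminal vertex,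 are $a_1,\dots,a_{p+1}$, then $b_1,\dots,b_{l+1}$, and $c_1,\dots,c_{q+1}$. Statement. Let $G_w$ be a weighted bicyclic graph without pendant vertices. Then $i_+(G_w)=2$ if and only if $G_w$ is isomorphic, as a weighted graph, to one of the following, with weights satisfying the condition stated: 1. $\infty(3,1,3)_w$ (no condition on the weights); 2. $\infty(3,2,3)_w$ with $4a_1a_3b_1b_3-a_2b_2c_1^2\ge 0$; 3. $\infty(3,1,4)_w$ with $b_1b_3=b_2b_4$; 4. $\infty(4,1,4)_w$ with $a_1a_3=a_2a_4$ and $b_1b_3=b_2b_4$; 5. $\theta(1,1,1)_w$ with $a_2b_1\ne a_1b_2$ or $a_2c_1\ne a_1c_2$; 6. $\theta(1,0,1)_w$ with $a_2c_1\ne a_1c_2$; 7. $\theta(1,0,2)_w$ with $b_1c_2\ge c_1c_3$; 8. $\theta(2,0,2)_w$ with $a_2b_1c_2=a_1a_3c_2+a_2c_1c_3$. Moreover, the conditions do not depend on the choice of the isomorphism: whenever $G_w$ is isomorphic to one of these eight weighted graphs with some weights $a_i,b_i,c_i$ as above, $i_+(G_w)=2$ holds if and only if those weights satisfy the condition listed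 for that graph (always, in case 1). -/

import Mathlib

/-- A simple graph on `V` with positive edge weights. Only the values of `weight` on the edges of
`graph` carry meaning; its values on other unordered pairs are never used. -/
structure WeightedGraph (V : Type*) where
  graph : SimpleGraph V
  weight : Sym2 V → ℝ
  weight_pos : ∀ e ∈ graph.edgeSet, 0 < weight e

namespace WeightedGraph

variable {V : Type*}

open Classical in
/-- The weighted adjacency matrix: the weight of the edge `ij` if `i` and `j` are adjacent,
and `0` otherwise. -/
noncomputable def adjMatrix (W : WeightedGraph V) : Matrix V V ℝ :=
  Matrix.of fun i j => if W.graph.Adj i j then W.weight s(i, j) else 0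

theorem isHermitian_adjMatrix (W : WeightedGraph V) : W.adjMatrix.IsHermitian := by
  ext i j
  have h := W.graph.adj_comm j i
  by_cases hij : W.graph.Adj i j <;>
    simp [adjMatrix, Matrix.conjTranspose_apply, h, hij, Sym2.eq_swap (a := j) (b := i)]

/-- The positive index of inertia: the number of positive eigenvalues of the adjacency matrix,
counted with multiplicity. -/
noncomputable def posIndex [Fintype V] [DecidableEq V] (W : WeightedGraph V) : ℕ :=
  (Finset.univ.filter fun i => 0 < W.isHermitian_adjMatrix.eigenvalues i).card

end WeightedGraph

/-- A bicyclic graph: connected, and with one more edge than vertices. -/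
def IsBicyclic {V : Type*} (G : SimpleGraph V) : Prop :=
  G.Connected ∧ G.edgeSet.ncard = Nat.card V + 1

/-- A pendant vertex: a vertex with exactly one neighbour. -/
def IsPendant {V : Type*} (G : SimpleGraph V) (v : V) : Prop :=
  (G.neighborSet v).ncard = 1

/-- The vertex sequence `s, m 0, …, m (k - 1), t`, whose entries have the indices `0, …, k + 1`. -/
def pathSeq {V : Type*} {k : ℕ} (s t : V) (m : Fin k → V) (i : ℕ) : V :=
  if i = 0 then s else if h : i - 1 < k then m ⟨i - 1, h⟩ else t

/-- The vertices of `∞(p, l, q)`: the vertex `v₁`, then the other vertices of the first cycle, the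
vertices `v₂, …, v_l` of the connecting path, and the vertices other than `v_l` of the second
cycle. -/
abbrev InftyVertex (p l q : ℕ) : Type :=
  Unit ⊕ Fin (p - 1) ⊕ Fin (l - 1) ⊕ Fin (q - 1)

namespace Infty

variable (p l q : ℕ)

/-- The first cycle, starting (index `0`) and ending (index `p`) at `v₁`. -/
def cycleA : ℕ → InftyVertex p l q :=
  pathSeq (Sum.inl ()) (Sum.inl ()) fun j : Fin (p - 1) => Sum.inr (Sum.inl j)

/-- The connecting path: the index `j` in `{0, …, l - 1}` gives `v_{j + 1}`. -/
def pathC : ℕ → InftyVertex p l q :=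
  pathSeq (Sum.inl ()) (Sum.inl ()) fun j : Fin (l - 1) => Sum.inr (Sum.inr (Sum.inl j))

/-- The second cycle, starting (index `0`) and ending (index `q`) at `v_l`. -/
def cycleB : ℕ → InftyVertex p l q :=
  pathSeq (pathC p l q (l - 1)) (pathC p l q (l - 1))
    fun j : Fin (q - 1) => Sum.inr (Sum.inr (Sum.inr j))

end Infty

/-- The graph `∞(p, l, q)` (for `p, q ≥ 3` and `l ≥ 1`): two disjoint cycles of lengths `p` and `q`,
joined by identifying a vertex of each with the two ends of a path on `l` vertices. -/
def inftyGraph (p l q : ℕ) : SimpleGraph (InftyVertex p l q) :=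
  SimpleGraph.fromEdgeSet
    ({e | ∃ i, 1 ≤ i ∧ i ≤ p ∧ e = s(Infty.cycleA p l q (i - 1), Infty.cycleA p l q i)} ∪
     {e | ∃ i, 1 ≤ i ∧ i ≤ q ∧ e = s(Infty.cycleB p l q (i - 1), Infty.cycleB p l q i)} ∪
     {e | ∃ i, 1 ≤ i ∧ i ≤ l - 1 ∧ e = s(Infty.pathC p l q (i - 1), Infty.pathC p l q i)})

/-- The vertices of `θ(p, l, q)`: the two common ends of the three paths (`false` for the initial
vertex and `true` for the terminal one), and the `p`, `l`, `q` inner vertices of the paths. -/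
abbrev ThetaVertex (p l q : ℕ) : Type :=
  Bool ⊕ Fin p ⊕ Fin l ⊕ Fin q

namespace Theta

variable (p l q : ℕ)

/-- The first path, with indices `0, …, p + 1`. -/
def pathA : ℕ → ThetaVertex p l q :=
  pathSeq (Sum.inl false) (Sum.inl true) fun j : Fin p => Sum.inr (Sum.inl j)

/-- The second path, with indices `0, …, l + 1`. -/
def pathB : ℕ → ThetaVertex p l q :=
  pathSeq (Sum.inl false) (Sum.inl true) fun j : Fin l => Sum.inr (Sum.inr (Sum.inl j))

/-- The third path, with indices `0, …, q + 1`. -/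
def pathC : ℕ → ThetaVertex p l q :=
  pathSeq (Sum.inl false) (Sum.inl true) fun j : Fin q => Sum.inr (Sum.inr (Sum.inr j))

end Theta

/-- The graph `θ(p, l, q)` (with at most one of `p, l, q` equal to `0`): three paths on `p + 2`,
`l + 2` and `q + 2` vertices with their initial vertices identified and their terminal vertices
identified. -/
def thetaGraph (p l q : ℕ) : SimpleGraph (ThetaVertex p l q) :=
  SimpleGraph.fromEdgeSet
    ({e | ∃ i, 1 ≤ i ∧ i ≤ p + 1 ∧ e = s(Theta.pathA p l q (i - 1), Theta.pathA p l q i)} ∪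
     {e | ∃ i, 1 ≤ i ∧ i ≤ l + 1 ∧ e = s(Theta.pathB p l q (i - 1), Theta.pathB p l q i)} ∪
     {e | ∃ i, 1 ≤ i ∧ i ≤ q + 1 ∧ e = s(Theta.pathC p l q (i - 1), Theta.pathC p l q i)})

namespace WeightedGraph

variable {V : Type*}

/-- `W` is isomorphic to the weighted graph `∞(p, l, q)_w` whose edges have the weights
`a 1, …, a p` along the first cycle (from `v₁` round to `v₁`), `b 1, …, b q` along the second cycle
(from `v_l` round to `v_l`) and `c 1, …, c (l - 1)` along the path from `v₁` to `v_l`. -/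
def IsInfty (W : WeightedGraph V) (p l q : ℕ) (a b c : ℕ → ℝ) : Prop :=
  ∃ φ : inftyGraph p l q ≃g W.graph,
    (∀ i, 1 ≤ i → i ≤ p →
      W.weight s(φ (Infty.cycleA p l q (i - 1)), φ (Infty.cycleA p l q i)) = a i) ∧
    (∀ i, 1 ≤ i → i ≤ q →
      W.weight s(φ (Infty.cycleB p l q (i - 1)), φ (Infty.cycleB p l q i)) = b i) ∧
    (∀ i, 1 ≤ i → i ≤ l - 1 →
      W.weight s(φ (Infty.pathC p l q (i - 1)), φ (Infty.pathC p l q i)) = c i)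

/-- `W` is isomorphic to the weighted graph `θ(p, l, q)_w` whose edges have, from the initial to the
terminal vertex, the weights `a 1, …, a (p + 1)` along the first path, `b 1, …, b (l + 1)` along the
second and `c 1, …, c (q + 1)` along the third. -/
def IsTheta (W : WeightedGraph V) (p l q : ℕ) (a b c : ℕ → ℝ) : Prop :=
  ∃ φ : thetaGraph p l q ≃g W.graph,
    (∀ i, 1 ≤ i → i ≤ p + 1 →
      W.weight s(φ (Theta.pathA p l q (i - 1)), φ (Theta.pathA p l q i)) = a i) ∧
    (∀ i, 1 ≤ i → i ≤ l + 1 →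
      W.weight s(φ (Theta.pathB p l q (i - 1)), φ (Theta.pathB p l q i)) = b i) ∧
    (∀ i, 1 ≤ i → i ≤ q + 1 →
      W.weight s(φ (Theta.pathC p l q (i - 1)), φ (Theta.pathC p l q i)) = c i)

end WeightedGraph

open Matrix

set_option linter.unusedSimpArgs false

namespace WeightedGraph

/-! The positive index is treated through the quadratic form of the adjacency matrix. It is at least
`k` once the form is positive definite on a `k`-dimensional space (`le_posIndex`), and at most `k`
once the form is nonpositive on the common kernel of `k` linear functionals (`posIndex_le`).

The main lower bound is `le_posIndex_of_det_ne_zero`: pairwise non-adjacent rows carrying an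
invertible `k × k` block of the matrix force index at least `k`. It gives two configurations that
force index 3 whatever the weights: an ordered matching of three edges and an induced hexagon. A
pentagon with a possible chord needs a weight inequality, which is automatic when the chord is
absent.

For each of the eight models, the weight condition is what makes the form nonpositive on the kernel
of two functionals, or, for θ(1,1,1) and θ(1,0,1), what keeps the index above 1. When the condition
fails, a nonzero 3 × 3 minor, three orthogonal positive vectors, or a single functional gives the
wrong index. The criterion is proved for an arbitrary labelling, so it cannot depend on the
isomorphism.

It remains to see that no other graph has index at most 2. In a bicyclic graph without pendant
vertices the excesses of the degrees over 2 add up to 2 (`degrees_of_isBicyclic`), so there is one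
vertex of degree four or there are two of degree three. Following the threads of degree-two vertices
from these, any thread that is too long produces a forbidden configuration. The remaining
neighbourhood data determine the graph, since an injective map onto whole neighbourhoods in a
connected graph is an isomorphism (`nonempty_iso_of_local_iso`). -/

theorem adjMatrix_swap {V : Type*} (W : WeightedGraph V) (i j : V) :
    W.adjMatrix i j = W.adjMatrix j i := by
  simpa using (W.isHermitian_adjMatrix.apply j i)

/-! ### Bounds for the positive index from subspaces and minors -/

section Inertia

variable {V : Type*} [Fintype V] [DecidableEq V] (W : WeightedGraph V)

/-- In the coordinates given by an orthonormal basis of eigenvectors, the quadratic form of the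
adjacency matrix is diagonal, with the eigenvalues as coefficients. -/
theorem exists_diagonalization : ∃ U : Matrix V V ℝ, U * Uᵀ = 1 ∧ Uᵀ * U = 1 ∧
    ∀ y : V → ℝ, (U *ᵥ y) ⬝ᵥ W.adjMatrix *ᵥ (U *ᵥ y) =
      ∑ i, W.isHermitian_adjMatrix.eigenvalues i * y i ^ 2 := by
  set hA := W.isHermitian_adjMatrix
  set U : Matrix V V ℝ := ↑hA.eigenvectorUnitary with hU
  have h1 : U * Uᵀ = 1 := by
    have := (Matrix.mem_unitaryGroup_iff).1 hA.eigenvectorUnitary.2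
    simpa [Matrix.star_eq_conjTranspose] using this
  have h2 : Uᵀ * U = 1 := by
    have := (Matrix.mem_unitaryGroup_iff').1 hA.eigenvectorUnitary.2
    simpa [Matrix.star_eq_conjTranspose] using this
  refine ⟨U, h1, h2, fun y => ?_⟩
  have key : Uᵀ * W.adjMatrix * U = diagonal hA.eigenvalues := by
    have h := hA.spectral_theorem
    rw [Unitary.conjStarAlgAut_apply] at h
    have h' : W.adjMatrix = U * diagonal hA.eigenvalues * Uᵀ := by
      simpa [Matrix.star_eq_conjTranspose, Function.comp_def] using h
    calc Uᵀ * W.adjMatrix * U = Uᵀ * (U * diagonal hA.eigenvalues * Uᵀ) * U := by rw [← h']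
      _ = (Uᵀ * U) * diagonal hA.eigenvalues * (Uᵀ * U) := by simp only [Matrix.mul_assoc]
      _ = _ := by simp [h2]
  have : (U *ᵥ y) ⬝ᵥ W.adjMatrix *ᵥ (U *ᵥ y) = y ⬝ᵥ (Uᵀ * W.adjMatrix * U) *ᵥ y := by
    rw [← Matrix.mulVec_mulVec, ← Matrix.mulVec_mulVec, Matrix.dotProduct_mulVec y Uᵀ,
      Matrix.vecMul_transpose]
  rw [this, key]
  simp only [dotProduct, mulVec_diagonal]
  exact Finset.sum_congr rfl fun i _ => by ring

theorem posIndex_eq_finrank : W.posIndex =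
    Module.finrank ℝ ({i // 0 < W.isHermitian_adjMatrix.eigenvalues i} → ℝ) := by
  rw [Module.finrank_fintype_fun_eq_card, Fintype.card_subtype, posIndex]

/-- The form is positive definite on a space of dimension `k`. -/
theorem le_posIndex {k : ℕ} (f : (Fin k → ℝ) →ₗ[ℝ] (V → ℝ))
    (hf : ∀ y ≠ 0, 0 < f y ⬝ᵥ W.adjMatrix *ᵥ f y) : k ≤ W.posIndex := by
  obtain ⟨U, h1, h2, hQ⟩ := W.exists_diagonalization
  -- Projection to the eigencoordinates with positive eigenvalue. It is injective on the image of
  -- `f`: a vector with no such coordinates has nonpositive form.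
  let r : (Fin k → ℝ) →ₗ[ℝ] ({i // 0 < W.isHermitian_adjMatrix.eigenvalues i} → ℝ) :=
    (LinearMap.funLeft ℝ ℝ Subtype.val) ∘ₗ Uᵀ.mulVecLin ∘ₗ f
  have hr : Function.Injective r := by
    rw [← LinearMap.ker_eq_bot, LinearMap.ker_eq_bot']
    intro y hy
    by_contra hne
    have hpos := hf y hne
    have hx : f y = U *ᵥ (Uᵀ *ᵥ f y) := by simp [h1]
    rw [hx, hQ] at hpos
    refine absurd hpos (not_lt.2 (Finset.sum_nonpos fun i _ => ?_))
    by_cases hi : 0 < W.isHermitian_adjMatrix.eigenvalues i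
    · have : (Uᵀ *ᵥ f y) i = 0 := congrFun hy ⟨i, hi⟩
      simp [this]
    · exact mul_nonpos_of_nonpos_of_nonneg (not_lt.1 hi) (sq_nonneg _)
  have := LinearMap.finrank_le_finrank_of_injective hr
  rwa [← posIndex_eq_finrank, Module.finrank_fin_fun] at this

/-- The form is nonpositive on a space of codimension at most `k`. -/
theorem posIndex_le {k : ℕ} (g : (V → ℝ) →ₗ[ℝ] (Fin k → ℝ))
    (hg : ∀ x, g x = 0 → x ⬝ᵥ W.adjMatrix *ᵥ x ≤ 0) : W.posIndex ≤ k := by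
  obtain ⟨U, h1, h2, hQ⟩ := W.exists_diagonalization
  -- Restriction of `g` to the span of the eigenvectors with positive eigenvalue, where the form is
  -- positive definite; its kernel must therefore vanish.
  let r : ({i // 0 < W.isHermitian_adjMatrix.eigenvalues i} → ℝ) →ₗ[ℝ] (Fin k → ℝ) :=
    g ∘ₗ U.mulVecLin ∘ₗ (Function.ExtendByZero.linearMap ℝ Subtype.val)
  have hr : Function.Injective r := by
    rw [← LinearMap.ker_eq_bot, LinearMap.ker_eq_bot']
    intro z hz
    have h := hg _ hz
    change (U *ᵥ _) ⬝ᵥ W.adjMatrix *ᵥ (U *ᵥ _) ≤ 0 at h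
    rw [hQ] at h
    set y := (Function.ExtendByZero.linearMap ℝ Subtype.val) z with hy
    have hval : ∀ i, y i.1 = z i := fun i => by
      rw [hy]; exact Subtype.val_injective.extend_apply z 0 i
    have hnn : ∀ i ∈ Finset.univ, 0 ≤ W.isHermitian_adjMatrix.eigenvalues i * y i ^ 2 := by
      intro i _
      by_cases hi : 0 < W.isHermitian_adjMatrix.eigenvalues i
      · positivity
      · have : y i = 0 := by
          rw [hy]
          refine Function.extend_apply' _ _ _ ?_
          rintro ⟨a, rfl⟩
          exact hi a.2
        simp [this]
    have h0 := (Finset.sum_eq_zero_iff_of_nonneg hnn).1 (le_antisymm h (Finset.sum_nonneg hnn))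
    funext i
    have := h0 i.1 (Finset.mem_univ _)
    rw [hval] at this
    simpa [i.2.ne'] using this
  have := LinearMap.finrank_le_finrank_of_injective hr
  rwa [← posIndex_eq_finrank, Module.finrank_fin_fun] at this

/-- In the basis `w` the form is a sum of squares with positive coefficients, so linear independence
need not be assumed. -/
theorem le_posIndex_of_orthogonal {k : ℕ} (w : Fin k → V → ℝ)
    (horth : ∀ i j, i ≠ j → w i ⬝ᵥ W.adjMatrix *ᵥ w j = 0)
    (hpos : ∀ i, 0 < w i ⬝ᵥ W.adjMatrix *ᵥ w i) : k ≤ W.posIndex := by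
  refine W.le_posIndex (Fintype.linearCombination ℝ w) fun y hy => ?_
  have : Fintype.linearCombination ℝ w y ⬝ᵥ W.adjMatrix *ᵥ Fintype.linearCombination ℝ w y =
      ∑ i, y i ^ 2 * (w i ⬝ᵥ W.adjMatrix *ᵥ w i) := by
    simp only [Fintype.linearCombination_apply, sum_dotProduct, mulVec_sum, dotProduct_sum,
      mulVec_smul, smul_dotProduct, dotProduct_smul, smul_eq_mul]
    refine Finset.sum_congr rfl fun i _ => ?_
    rw [Finset.sum_eq_single i]
    · ring
    · intro j _ hj; rw [horth j i hj]; simp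
    · simp
  rw [this]
  obtain ⟨i, hi⟩ := Function.ne_iff.1 hy
  refine Finset.sum_pos' (fun i _ => mul_nonneg (sq_nonneg _) (hpos i).le)
    ⟨i, Finset.mem_univ _, mul_pos (sq_pos_of_ne_zero hi) (hpos i)⟩

theorem single_form (a b : V) (c d : ℝ) :
    (Pi.single a c : V → ℝ) ⬝ᵥ W.adjMatrix *ᵥ (Pi.single b d) = c * W.adjMatrix a b * d := by
  simp [mul_assoc, mul_comm d]

theorem abs_quadratic_le {k : ℕ} (C : Fin k → Fin k → ℝ) (y : Fin k → ℝ) :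
    - ((∑ i, ∑ j, |C i j|) * ∑ l, y l ^ 2) ≤ ∑ i, ∑ j, y i * C i j * y j := by
  rw [Finset.sum_mul, ← Finset.sum_neg_distrib]
  refine Finset.sum_le_sum fun i _ => ?_
  rw [Finset.sum_mul, ← Finset.sum_neg_distrib]
  refine Finset.sum_le_sum fun j _ => ?_
  have hi := Finset.single_le_sum (f := fun l => y l ^ 2) (fun l _ => sq_nonneg _)
    (Finset.mem_univ i)
  have hj := Finset.single_le_sum (f := fun l => y l ^ 2) (fun l _ => sq_nonneg _)
    (Finset.mem_univ j)
  have h2 : |y i| * |y j| ≤ ∑ l, y l ^ 2 := by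
    nlinarith [sq_nonneg (|y i| - |y j|), sq_abs (y i), sq_abs (y j)]
  calc -(|C i j| * ∑ l, y l ^ 2) ≤ -(|C i j| * (|y i| * |y j|)) := by
        gcongr
    _ = -|y i * C i j * y j| := by rw [abs_mul, abs_mul]; ring
    _ ≤ _ := neg_abs_le _

/-- If the vertices `u i` are pairwise non-adjacent and the block of the adjacency matrix with rows
`u` and columns `v` is invertible, then the positive index is at least the size of the block. -/
theorem le_posIndex_of_det_ne_zero {k : ℕ} (u v : Fin k → V)
    (hu : ∀ i j, W.adjMatrix (u i) (u j) = 0)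
    (hB : (W.adjMatrix.submatrix u v).det ≠ 0) : k ≤ W.posIndex := by
  set B := W.adjMatrix.submatrix u v with hBdef
  set K : ℝ := ∑ i, ∑ j, |W.adjMatrix (v i) (v j)|
  have hK : 0 ≤ K := Finset.sum_nonneg fun _ _ => Finset.sum_nonneg fun _ _ => abs_nonneg _
  let eu : (Fin k → ℝ) →ₗ[ℝ] (V → ℝ) := Fintype.linearCombination ℝ fun i => Pi.single (u i) 1
  let ev : (Fin k → ℝ) →ₗ[ℝ] (V → ℝ) := Fintype.linearCombination ℝ fun i => Pi.single (v i) 1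
  have form : ∀ (p q : Fin k → V) (x y : Fin k → ℝ),
      Fintype.linearCombination ℝ (fun i => (Pi.single (p i) 1 : V → ℝ)) x ⬝ᵥ
        W.adjMatrix *ᵥ Fintype.linearCombination ℝ (fun i => (Pi.single (q i) 1 : V → ℝ)) y =
      ∑ i, ∑ j, x i * W.adjMatrix (p i) (q j) * y j := by
    intro p q x y
    simp only [Fintype.linearCombination_apply, sum_dotProduct, mulVec_sum, dotProduct_sum,
      mulVec_smul, smul_dotProduct, dotProduct_smul, smul_eq_mul, single_form]
    simp only [Finset.mul_sum]
    rw [Finset.sum_comm]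
    exact Finset.sum_congr rfl fun i _ => Finset.sum_congr rfl fun j _ => by ring
  -- The `u`-part is isotropic, so choosing it as `(K + 1) B⁻ᵀ y` makes the cross terms contribute
  -- `2 (K + 1) |y|²`. This dominates the `v`-block, which is at least `-K |y|²`.
  refine W.le_posIndex (eu ∘ₗ ((K + 1) • (B⁻¹)ᵀ.mulVecLin) + ev) fun y hy => ?_
  set x := (K + 1) • ((B⁻¹)ᵀ *ᵥ y) with hx
  have hxy : ∑ i, ∑ j, x i * W.adjMatrix (u i) (v j) * y j = (K + 1) * ∑ l, y l ^ 2 := by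
    have : ∑ i, ∑ j, x i * W.adjMatrix (u i) (v j) * y j = x ⬝ᵥ B *ᵥ y := by
      simp only [dotProduct, mulVec, Finset.mul_sum, hBdef, submatrix_apply, mul_assoc]
    rw [this, hx, smul_dotProduct, mulVec_transpose, ← dotProduct_mulVec, mulVec_mulVec,
      Matrix.nonsing_inv_mul _ (isUnit_iff_ne_zero.2 hB), one_mulVec, smul_eq_mul]
    simp only [dotProduct, sq]
  have hyx : ∑ i, ∑ j, y i * W.adjMatrix (v i) (u j) * x j = (K + 1) * ∑ l, y l ^ 2 := by
    rw [← hxy, Finset.sum_comm]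
    refine Finset.sum_congr rfl fun i _ => Finset.sum_congr rfl fun j _ => ?_
    rw [W.adjMatrix_swap]; ring
  have hfy : (eu ∘ₗ ((K + 1) • (B⁻¹)ᵀ.mulVecLin) + ev) y = eu x + ev y := rfl
  rw [hfy, mulVec_add, dotProduct_add, add_dotProduct, add_dotProduct, form, form, form, form, hxy,
    hyx]
  have h0 : ∑ i, ∑ j, x i * W.adjMatrix (u i) (u j) * x j = 0 := by simp [hu]
  have h3 := abs_quadratic_le (fun i j => W.adjMatrix (v i) (v j)) y
  have hy2 : 0 < ∑ l, y l ^ 2 := by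
    obtain ⟨i, hi⟩ := Function.ne_iff.1 hy
    exact Finset.sum_pos' (fun i _ => sq_nonneg _) ⟨i, Finset.mem_univ _, sq_pos_of_ne_zero hi⟩
  change -(K * _) ≤ _ at h3
  rw [h0]
  nlinarith

end Inertia

end WeightedGraph

namespace WeightedGraph

theorem adjMatrix_of_adj {V : Type*} (W : WeightedGraph V) {i j : V} (h : W.graph.Adj i j) :
    W.adjMatrix i j = W.weight s(i, j) := by
  simp [adjMatrix, h]

theorem adjMatrix_pos {V : Type*} (W : WeightedGraph V) {i j : V} (h : W.graph.Adj i j) :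
    0 < W.adjMatrix i j := by
  rw [W.adjMatrix_of_adj h]
  exact W.weight_pos _ h

theorem adjMatrix_eq_zero {V : Type*} (W : WeightedGraph V) {i j : V} (h : ¬ W.graph.Adj i j) :
    W.adjMatrix i j = 0 := by
  simp [adjMatrix, h]

/-! ### Configurations that force a large index -/

section Patterns

variable {V : Type*} [Fintype V] [DecidableEq V] (W : WeightedGraph V)

theorem two_le_posIndex {u₁ u₂ v₁ v₂ : V} (hu : ¬ W.graph.Adj u₁ u₂)
    (hB : W.adjMatrix u₁ v₁ * W.adjMatrix u₂ v₂ - W.adjMatrix u₁ v₂ * W.adjMatrix u₂ v₁ ≠ 0) :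
    2 ≤ W.posIndex := by
  have hu' : ¬ W.graph.Adj u₂ u₁ := fun h => hu h.symm
  refine W.le_posIndex_of_det_ne_zero ![u₁, u₂] ![v₁, v₂] ?_ ?_
  · intro i j
    fin_cases i <;> fin_cases j <;> simp [adjMatrix_eq_zero, hu, hu']
  · rw [det_fin_two]; exact hB

theorem three_le_posIndex {u₁ u₂ u₃ v₁ v₂ v₃ : V} (h₁₂ : ¬ W.graph.Adj u₁ u₂)
    (h₁₃ : ¬ W.graph.Adj u₁ u₃) (h₂₃ : ¬ W.graph.Adj u₂ u₃)
    (hB : W.adjMatrix u₁ v₁ * W.adjMatrix u₂ v₂ * W.adjMatrix u₃ v₃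
      - W.adjMatrix u₁ v₁ * W.adjMatrix u₂ v₃ * W.adjMatrix u₃ v₂
      - W.adjMatrix u₁ v₂ * W.adjMatrix u₂ v₁ * W.adjMatrix u₃ v₃
      + W.adjMatrix u₁ v₂ * W.adjMatrix u₂ v₃ * W.adjMatrix u₃ v₁
      + W.adjMatrix u₁ v₃ * W.adjMatrix u₂ v₁ * W.adjMatrix u₃ v₂
      - W.adjMatrix u₁ v₃ * W.adjMatrix u₂ v₂ * W.adjMatrix u₃ v₁ ≠ 0) :
    3 ≤ W.posIndex := by
  have h₂₁ : ¬ W.graph.Adj u₂ u₁ := fun h => h₁₂ h.symm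
  have h₃₁ : ¬ W.graph.Adj u₃ u₁ := fun h => h₁₃ h.symm
  have h₃₂ : ¬ W.graph.Adj u₃ u₂ := fun h => h₂₃ h.symm
  refine W.le_posIndex_of_det_ne_zero ![u₁, u₂, u₃] ![v₁, v₂, v₃] ?_ ?_
  · intro i j
    fin_cases i <;> fin_cases j <;> simp [adjMatrix_eq_zero, *]
  · rw [det_fin_three]; exact hB

/-- An induced bipartite subgraph with an ordered matching of three edges. -/
theorem three_le_posIndex_of_triangular {u₁ u₂ u₃ v₁ v₂ v₃ : V} (h₁₂ : ¬ W.graph.Adj u₁ u₂)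
    (h₁₃ : ¬ W.graph.Adj u₁ u₃) (h₂₃ : ¬ W.graph.Adj u₂ u₃) (h₁ : W.graph.Adj u₁ v₁)
    (h₂ : W.graph.Adj u₂ v₂) (h₃ : W.graph.Adj u₃ v₃) (k₁₂ : ¬ W.graph.Adj u₁ v₂)
    (k₁₃ : ¬ W.graph.Adj u₁ v₃) (k₂₃ : ¬ W.graph.Adj u₂ v₃) : 3 ≤ W.posIndex := by
  -- The block is lower triangular, so its determinant is the product of the weights of the three
  -- matched edges.
  refine W.three_le_posIndex (v₁ := v₁) (v₂ := v₂) (v₃ := v₃) h₁₂ h₁₃ h₂₃ ?_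
  simp [W.adjMatrix_eq_zero k₁₂, W.adjMatrix_eq_zero k₁₃, W.adjMatrix_eq_zero k₂₃,
    (W.adjMatrix_pos h₁).ne', (W.adjMatrix_pos h₂).ne', (W.adjMatrix_pos h₃).ne']

/-- An induced cycle of length six. -/
theorem three_le_posIndex_of_hexagon {u₁ u₂ u₃ v₁ v₂ v₃ : V} (h₁₂ : ¬ W.graph.Adj u₁ u₂)
    (h₁₃ : ¬ W.graph.Adj u₁ u₃) (h₂₃ : ¬ W.graph.Adj u₂ u₃) (h₁ : W.graph.Adj u₁ v₁)
    (h₂ : W.graph.Adj u₂ v₂) (h₃ : W.graph.Adj u₃ v₃) (k₁₂ : W.graph.Adj u₁ v₂)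
    (k₂₃ : W.graph.Adj u₂ v₃) (k₃₁ : W.graph.Adj u₃ v₁) (k₁₃ : ¬ W.graph.Adj u₁ v₃)
    (k₂₁ : ¬ W.graph.Adj u₂ v₁) (k₃₂ : ¬ W.graph.Adj u₃ v₂) : 3 ≤ W.posIndex := by
  refine W.three_le_posIndex (v₁ := v₁) (v₂ := v₂) (v₃ := v₃) h₁₂ h₁₃ h₂₃ ?_
  rw [W.adjMatrix_eq_zero k₁₃, W.adjMatrix_eq_zero k₂₁, W.adjMatrix_eq_zero k₃₂]
  have := W.adjMatrix_pos h₁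
  have := W.adjMatrix_pos h₂
  have := W.adjMatrix_pos h₃
  have := W.adjMatrix_pos k₁₂
  have := W.adjMatrix_pos k₂₃
  have := W.adjMatrix_pos k₃₁
  -- The two perfect matchings of a hexagon enter the determinant with the same sign, so they cannot
  -- cancel, unlike those of a 4-cycle.
  simp only [mul_zero, zero_mul, sub_zero, add_zero]
  positivity

/-- An induced cycle `s x t z y` of length five, with a possible chord `s t`. -/
theorem three_le_posIndex_of_pentagon {s x t z y : V} (hsx : W.graph.Adj s x)
    (hxt : W.graph.Adj x t) (htz : W.graph.Adj t z) (hzy : W.graph.Adj z y) (hys : W.graph.Adj y s)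
    (hxz : ¬ W.graph.Adj x z) (hxy : ¬ W.graph.Adj x y) (hsz : ¬ W.graph.Adj s z)
    (hty : ¬ W.graph.Adj t y)
    (hlt : W.adjMatrix s t * W.adjMatrix y z < W.adjMatrix s y * W.adjMatrix z t) :
    3 ≤ W.posIndex := by
  have e : ∀ i j, ¬ W.graph.Adj i j → W.adjMatrix i j = 0 ∧ W.adjMatrix j i = 0 := fun i j h =>
    ⟨W.adjMatrix_eq_zero h, W.adjMatrix_eq_zero fun h' => h h'.symm⟩
  obtain ⟨e1, e1'⟩ := e _ _ hxz
  obtain ⟨e2, e2'⟩ := e _ _ hxy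
  obtain ⟨e3, e3'⟩ := e _ _ hsz
  obtain ⟨e4, e4'⟩ := e _ _ hty
  have e0 : ∀ i, W.adjMatrix i i = 0 := fun i => W.adjMatrix_eq_zero (W.graph.irrefl)
  have p1 := W.adjMatrix_pos hsx
  have p2 := W.adjMatrix_pos hxt
  have p3 := W.adjMatrix_pos htz
  have p4 := W.adjMatrix_pos hzy
  have p5 := W.adjMatrix_pos hys
  have q1 := W.adjMatrix_swap x s
  have q2 := W.adjMatrix_swap t x
  have q3 := W.adjMatrix_swap z t
  have q4 := W.adjMatrix_swap y z
  have q5 := W.adjMatrix_swap s y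
  have q6 := W.adjMatrix_swap t s
  rw [q3, q4, q5] at hlt
  set a₁ := W.adjMatrix s x
  set a₂ := W.adjMatrix x t
  set c₁ := W.adjMatrix y s
  set c₂ := W.adjMatrix z y
  set c₃ := W.adjMatrix t z
  set b := W.adjMatrix s t
  have hd : 0 < c₁ * c₃ - b * c₂ := by linarith
  -- Splitting off the hyperbolic plane of the edge `yz` replaces `s` and `t` by `s - (c₁/c₂) z` and
  -- `t - (c₃/c₂) y`. With `x` they form a triangle with edges `a₁`, `a₂` and the negative edge `b -
  -- c₁c₃/c₂`, whose form has two positive directions. The three vectors are one from the plane and,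
  -- with denominators cleared, two orthogonal ones from this triangle.
  refine W.le_posIndex_of_orthogonal
    ![Pi.single y 1 + Pi.single z 1,
      Pi.single s (a₂ * c₂) + Pi.single t (-a₁ * c₂) + Pi.single y (a₁ * c₃) +
        Pi.single z (-a₂ * c₁),
      Pi.single s (a₂ * c₂ * c₂) + Pi.single t (a₁ * c₂ * c₂) + Pi.single y (-a₁ * c₃ * c₂) +
        Pi.single z (-a₂ * c₁ * c₂) + Pi.single x ((c₁ * c₃ - b * c₂) * c₂)] ?_ ?_
  · intro i j hij
    fin_cases i <;> fin_cases j <;> first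
      | exact absurd rfl hij
      | (simp [mulVec_add, add_dotProduct, dotProduct_add, single_form, -dotProduct_single,
          -single_dotProduct, -mulVec_single, e0, e1, e1', e2, e2', e3, e3',
          e4, e4', q1, q2, q3, q4, q5, q6]
         ring)
  · intro i
    fin_cases i
    · simp [mulVec_add, add_dotProduct, dotProduct_add, single_form, -dotProduct_single,
          -single_dotProduct, -mulVec_single, e0, q4]
      positivity
    · simp [mulVec_add, add_dotProduct, dotProduct_add, single_form, -dotProduct_single,
          -single_dotProduct, -mulVec_single, e0, e3, e3', e4, e4', q3,
          q4, q5, q6]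
      have : 0 < 2 * a₁ * a₂ * c₂ * (c₁ * c₃ - b * c₂) := by positivity
      linarith
    · simp [mulVec_add, add_dotProduct, dotProduct_add, single_form, -dotProduct_single,
          -single_dotProduct, -mulVec_single, e0, e1, e1', e2, e2', e3, e3',
          e4, e4', q1, q2, q3, q4, q5, q6]
      have : 0 < 2 * a₁ * a₂ * c₂ ^ 3 * (c₁ * c₃ - b * c₂) := by positivity
      linarith

end Patterns

end WeightedGraph

/-! ### Decidable adjacency in the model graphs -/

/-- `x` and `y` are joined by one of the first `n` edges of the walk `f`. -/
def StepAdj {α : Type*} (f : ℕ → α) (n : ℕ) (x y : α) : Prop :=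
  ∃ i ∈ Finset.Icc 1 n, (x = f (i - 1) ∧ y = f i) ∨ (x = f i ∧ y = f (i - 1))

instance {α : Type*} [DecidableEq α] (f : ℕ → α) (n : ℕ) (x y : α) : Decidable (StepAdj f n x y) :=
  inferInstanceAs
    (Decidable (∃ i ∈ Finset.Icc 1 n, (x = f (i - 1) ∧ y = f i) ∨ (x = f i ∧ y = f (i - 1))))

/-- Bounding the edge index makes adjacency decidable, so that `decide` settles it in each concrete
model. -/
theorem inftyGraph_adj (p l q : ℕ) (x y : InftyVertex p l q) : (inftyGraph p l q).Adj x y ↔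
    (StepAdj (Infty.cycleA p l q) p x y ∨ StepAdj (Infty.cycleB p l q) q x y ∨
      StepAdj (Infty.pathC p l q) (l - 1) x y) ∧ x ≠ y := by
  simp [inftyGraph, StepAdj, and_assoc, or_assoc, or_and_right]

theorem thetaGraph_adj (p l q : ℕ) (x y : ThetaVertex p l q) : (thetaGraph p l q).Adj x y ↔
    (StepAdj (Theta.pathA p l q) (p + 1) x y ∨ StepAdj (Theta.pathB p l q) (l + 1) x y ∨
      StepAdj (Theta.pathC p l q) (q + 1) x y) ∧ x ≠ y := by
  simp [thetaGraph, StepAdj, and_assoc, or_assoc, or_and_right]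

instance (p l q : ℕ) : DecidableRel (inftyGraph p l q).Adj := fun x y =>
  decidable_of_iff _ (inftyGraph_adj p l q x y).symm

instance (p l q : ℕ) : DecidableRel (thetaGraph p l q).Adj := fun x y =>
  decidable_of_iff _ (thetaGraph_adj p l q x y).symm

/-! ### The index of the eight models -/

namespace WeightedGraph

variable {V : Type*} [Fintype V] [DecidableEq V] {W : WeightedGraph V}

/-- The upper bound by functionals, transported to the vertex type of a model, where the form
expands into an explicit finite sum. -/
theorem posIndex_le_of_iso {α : Type*} [Fintype α] {H : SimpleGraph α} {k : ℕ}
    (φ : H ≃g W.graph) (g : Fin k → (α → ℝ) →ₗ[ℝ] ℝ)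
    (hg : ∀ x : α → ℝ, (∀ i, g i x = 0) →
      ∑ i, ∑ j, x i * W.adjMatrix (φ i) (φ j) * x j ≤ 0) : W.posIndex ≤ k := by
  refine W.posIndex_le ((LinearMap.pi g) ∘ₗ LinearMap.funLeft ℝ ℝ φ) fun x hx => ?_
  refine le_of_eq_of_le ?_ (hg (x ∘ φ) fun i => congrFun hx i)
  simp only [dotProduct, mulVec, Finset.mul_sum, Function.comp, ← mul_assoc]
  rw [← Equiv.sum_comp φ.toEquiv]
  refine Finset.sum_congr rfl fun i _ => ?_
  rw [← Equiv.sum_comp φ.toEquiv]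
  rfl

theorem adjMatrix_iso {V α : Type*} {W : WeightedGraph V} {H : SimpleGraph α} [DecidableRel H.Adj]
    (φ : H ≃g W.graph) (i j : α) :
    W.adjMatrix (φ i) (φ j) = if H.Adj i j then W.weight s(φ i, φ j) else 0 := by
  simp only [adjMatrix, Matrix.of_apply, φ.map_adj_iff]

/-- The weight of the edge `x y` of the model is `r`, in both orientations. -/
def EdgeWeight {V α : Type*} (W : WeightedGraph V) (φ : α → V) (x y : α) (r : ℝ) : Prop :=
  W.weight s(φ x, φ y) = r ∧ W.weight s(φ y, φ x) = r

theorem EdgeWeight.mk {V α : Type*} {W : WeightedGraph V} {H : SimpleGraph α}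
    (φ : H ≃g W.graph) (x y : α) {r : ℝ} (h : W.weight s(φ x, φ y) = r)
    (hadj : H.Adj x y) : 0 < r ∧ W.EdgeWeight φ x y r :=
  ⟨h ▸ W.weight_pos _ (φ.map_adj_iff.2 hadj), h, Sym2.eq_swap ▸ h⟩

/-- Up to `-a₁a₃v²`, the form times `a₂` is the product of `a₂x + a₃v` and `a₂y + a₁v`, and the
hyperplane makes these factors opposite. Here and below each edge is counted once, so this is half
of the matrix form. -/
theorem triangle_form_le {a₁ a₂ a₃ v x y : ℝ} (h : a₂ * x + a₂ * y + (a₁ + a₃) * v = 0) :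
    a₂ * (a₁ * v * x + a₂ * x * y + a₃ * y * v) ≤ -(a₁ * a₃ * v ^ 2) := by
  have : a₂ * y + a₁ * v = -(a₂ * x + a₃ * v) := by linarith
  have e : a₂ * (a₁ * v * x + a₂ * x * y + a₃ * y * v) =
      (a₂ * x + a₃ * v) * (a₂ * y + a₁ * v) - a₁ * a₃ * v ^ 2 := by ring
  rw [e, this]
  nlinarith [sq_nonneg (a₂ * x + a₃ * v)]

theorem triangle_form_nonpos {a₁ a₂ a₃ v x y : ℝ} (h₁ : 0 < a₁) (h₂ : 0 < a₂) (h₃ : 0 < a₃)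
    (h : a₂ * x + a₂ * y + (a₁ + a₃) * v = 0) : a₁ * v * x + a₂ * x * y + a₃ * y * v ≤ 0 := by
  have h' := triangle_form_le h
  have : 0 ≤ a₁ * a₃ * v ^ 2 := by positivity
  exact nonpos_of_mul_nonpos_right (by linarith) h₂

/-- The condition `hb` makes the form of the 4-cycle a product of two linear forms; on the
hyperplane one is a negative multiple of the other. -/
theorem square_form_nonpos {b₁ b₂ b₃ b₄ v x y z : ℝ} (h₂ : 0 < b₂) (hb : b₁ * b₃ = b₂ * b₄)
    (h : b₂ * b₂ * x + b₂ * b₃ * z + b₂ * y + b₁ * v = 0) :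
    b₁ * v * x + b₂ * x * y + b₃ * y * z + b₄ * z * v ≤ 0 := by
  refine nonpos_of_mul_nonpos_right (?_ : b₂ * _ ≤ 0) h₂
  have e : b₂ * y + b₁ * v = -(b₂ * (b₂ * x + b₃ * z)) := by linarith
  have : b₂ * (b₁ * v * x + b₂ * x * y + b₃ * y * z + b₄ * z * v) =
      (b₂ * x + b₃ * z) * (b₂ * y + b₁ * v) := by linear_combination -(z * v) * hb
  rw [this, e]
  nlinarith [mul_nonneg h₂.le (sq_nonneg (b₂ * x + b₃ * z))]

/-- The triangle bounds leave a binary form in `u` and `v`, and `hc` is the discriminant condition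
for it to be nonpositive. -/
theorem barbell_form_nonpos {a₁ a₂ a₃ b₁ b₂ b₃ c v x y u z w : ℝ} (ha₁ : 0 < a₁) (ha₂ : 0 < a₂)
    (ha₃ : 0 < a₃) (hb₂ : 0 < b₂)
    (hc : 4 * a₁ * a₃ * b₁ * b₃ - a₂ * b₂ * c ^ 2 ≥ 0)
    (h : a₂ * x + a₂ * y + (a₁ + a₃) * v = 0) (h' : b₂ * z + b₂ * w + (b₁ + b₃) * u = 0) :
    (a₁ * v * x + a₂ * x * y + a₃ * y * v) + (b₁ * u * z + b₂ * z * w + b₃ * w * u) + c * u * v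
      ≤ 0 := by
  have k := mul_le_mul_of_nonneg_left (triangle_form_le h) hb₂.le
  have k' := mul_le_mul_of_nonneg_left (triangle_form_le h') ha₂.le
  have hP : 0 < a₁ * a₃ * b₂ := by positivity
  have hR : -(a₁ * a₃ * b₂) * v ^ 2 - a₂ * b₁ * b₃ * u ^ 2 + c * a₂ * b₂ * u * v ≤ 0 := by
    refine nonpos_of_mul_nonpos_right (?_ : 4 * (a₁ * a₃ * b₂) * _ ≤ 0) (by positivity)
    have e : 4 * (a₁ * a₃ * b₂) *
        (-(a₁ * a₃ * b₂) * v ^ 2 - a₂ * b₁ * b₃ * u ^ 2 + c * a₂ * b₂ * u * v) =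
        -(2 * (a₁ * a₃ * b₂) * v - c * a₂ * b₂ * u) ^ 2 -
          a₂ * b₂ * u ^ 2 * (4 * a₁ * a₃ * b₁ * b₃ - a₂ * b₂ * c ^ 2) := by ring
    have : 0 ≤ a₂ * b₂ * u ^ 2 * (4 * a₁ * a₃ * b₁ * b₃ - a₂ * b₂ * c ^ 2) :=
      mul_nonneg (by positivity) hc
    rw [e]
    linarith [sq_nonneg (2 * (a₁ * a₃ * b₂) * v - c * a₂ * b₂ * u)]
  refine nonpos_of_mul_nonpos_right (?_ : (a₂ * b₂) * _ ≤ 0) (by positivity)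
  linarith

/-- Proportional weights make the form a product of two linear forms, which the hyperplane makes
opposite. -/
theorem theta_one_one_one_form_nonpos {a₁ a₂ b₁ b₂ c₁ c₂ s t x y z : ℝ} (ha₁ : 0 < a₁)
    (e₁ : a₂ * b₁ = a₁ * b₂) (e₂ : a₂ * c₁ = a₁ * c₂)
    (h : a₁ * x + b₁ * y + c₁ * z + a₁ * s + a₂ * t = 0) :
    s * (a₁ * x + b₁ * y + c₁ * z) + t * (a₂ * x + b₂ * y + c₂ * z) ≤ 0 := by
  refine nonpos_of_mul_nonpos_right (?_ : a₁ * _ ≤ 0) ha₁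
  have : a₁ * (s * (a₁ * x + b₁ * y + c₁ * z) + t * (a₂ * x + b₂ * y + c₂ * z)) =
      -(a₁ * x + b₁ * y + c₁ * z) ^ 2 := by
    linear_combination (a₁ * x + b₁ * y + c₁ * z) * h - t * y * e₁ - t * z * e₂
  linarith [sq_nonneg (a₁ * x + b₁ * y + c₁ * z)]

/-- Proportional weights let the two inner vertices merge into one variable `a₁x + c₁z`, and the
form becomes that of a triangle with weights `1`, `b`, `a₂`. -/
theorem theta_one_zero_one_form_nonpos {a₁ a₂ b c₁ c₂ s t x z : ℝ} (ha₁ : 0 < a₁) (ha₂ : 0 < a₂)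
    (hb : 0 < b) (e : a₂ * c₁ = a₁ * c₂)
    (h : b * a₁ * s + b * t + (1 + a₂) * (a₁ * x + c₁ * z) = 0) :
    b * s * t + x * (a₁ * s + a₂ * t) + z * (c₁ * s + c₂ * t) ≤ 0 := by
  have k := triangle_form_nonpos (x := a₁ * s) (y := t) (v := a₁ * x + c₁ * z) one_pos hb ha₂
    (by linarith)
  refine nonpos_of_mul_nonpos_right (?_ : a₁ * _ ≤ 0) ha₁
  refine le_of_eq_of_le ?_ k
  linear_combination -t * z * e

/-- The constraint `h'` removes `x` and forces `s * t ≤ 0`; the rest is `(b c₂ - c₁ c₃) s t` plus a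
product of two forms made opposite by `h`. -/
theorem theta_one_zero_two_form_nonpos {a₁ a₂ b c₁ c₂ c₃ s t x y z : ℝ} (ha₁ : 0 < a₁)
    (ha₂ : 0 < a₂) (hc₂ : 0 < c₂) (hc : b * c₂ ≥ c₁ * c₃)
    (h : c₂ * y + c₃ * t + c₂ * z + c₁ * s = 0) (h' : a₁ * s + a₂ * t = 0) :
    b * s * t + x * (a₁ * s + a₂ * t) + c₁ * s * y + c₂ * y * z + c₃ * z * t ≤ 0 := by
  refine nonpos_of_mul_nonpos_right (?_ : c₂ * _ ≤ 0) hc₂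
  have hst : s * t ≤ 0 := by
    refine nonpos_of_mul_nonpos_right (?_ : a₂ * _ ≤ 0) ha₂
    have : a₂ * (s * t) = -(a₁ * s ^ 2) := by linear_combination s * h'
    rw [this]
    have : 0 ≤ a₁ * s ^ 2 := by positivity
    linarith
  have hst' := mul_nonpos_of_nonneg_of_nonpos (sub_nonneg.2 hc) hst
  have : c₂ * (b * s * t + x * (a₁ * s + a₂ * t) + c₁ * s * y + c₂ * y * z + c₃ * z * t) =
      (b * c₂ - c₁ * c₃) * (s * t) - (c₂ * y + c₃ * t) ^ 2 := by
    linear_combination (c₂ * y + c₃ * t) * h + c₂ * x * h'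
  linarith [sq_nonneg (c₂ * y + c₃ * t)]

/-- Each long path contributes a product of two linear forms plus a multiple of `s * t`; `hc` says
that these multiples cancel the chord. -/
theorem theta_two_zero_two_form_nonpos {a₁ a₂ a₃ b c₁ c₂ c₃ s t x y z w : ℝ} (ha₂ : 0 < a₂)
    (hc₂ : 0 < c₂) (hc : a₂ * b * c₂ = a₁ * a₃ * c₂ + a₂ * c₁ * c₃)
    (h : a₂ * a₃ * t + a₂ * a₂ * x + a₂ * y + a₁ * s = 0)
    (h' : c₂ * c₃ * t + c₂ * c₂ * z + c₂ * w + c₁ * s = 0) :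
    b * s * t + a₁ * s * x + a₂ * x * y + a₃ * y * t + c₁ * s * z + c₂ * z * w + c₃ * w * t
      ≤ 0 := by
  refine nonpos_of_mul_nonpos_right (?_ : (a₂ * c₂) * _ ≤ 0) (by positivity)
  have e : a₂ * c₂ *
      (b * s * t + a₁ * s * x + a₂ * x * y + a₃ * y * t + c₁ * s * z + c₂ * z * w + c₃ * w * t) =
      -(a₂ * c₂ * (a₃ * t + a₂ * x) ^ 2) - a₂ * c₂ * (c₃ * t + c₂ * z) ^ 2 := by
    linear_combination s * t * hc + c₂ * (a₃ * t + a₂ * x) * h + a₂ * (c₃ * t + c₂ * z) * h'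
  have := mul_pos ha₂ hc₂
  rw [e]
  linarith [mul_nonneg this.le (sq_nonneg (a₃ * t + a₂ * x)),
    mul_nonneg this.le (sq_nonneg (c₃ * t + c₂ * z))]

theorem posIndex_infty_three_one_three {a b c : ℕ → ℝ} (h : W.IsInfty 3 1 3 a b c) :
    W.posIndex = 2 := by
  obtain ⟨φ, hA, hB, -⟩ := h
  obtain ⟨pA1, hA1, hA1'⟩ := EdgeWeight.mk φ (.inl ()) (.inr (.inl 0))
    (hA 1 (by simp) (by simp)) (by decide)
  obtain ⟨pA2, hA2, hA2'⟩ := EdgeWeight.mk φ (.inr (.inl 0)) (.inr (.inl 1))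
    (hA 2 (by simp) (by simp)) (by decide)
  obtain ⟨pA3, hA3, hA3'⟩ := EdgeWeight.mk φ (.inr (.inl 1)) (.inl ())
    (hA 3 (by simp) (by simp)) (by decide)
  obtain ⟨pB1, hB1, hB1'⟩ := EdgeWeight.mk φ (.inl ()) (.inr (.inr (.inr 0)))
    (hB 1 (by simp) (by simp)) (by decide)
  obtain ⟨pB2, hB2, hB2'⟩ := EdgeWeight.mk φ (.inr (.inr (.inr 0))) (.inr (.inr (.inr 1)))
    (hB 2 (by simp) (by simp)) (by decide)
  obtain ⟨pB3, hB3, hB3'⟩ := EdgeWeight.mk φ (.inr (.inr (.inr 1))) (.inl ())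
    (hB 3 (by simp) (by simp)) (by decide)
  apply le_antisymm
  · refine posIndex_le_of_iso φ ![
        a 2 • .proj (.inr (.inl 0)) + a 2 • .proj (.inr (.inl 1)) + (a 1 + a 3) • .proj (.inl ()),
        b 2 • .proj (.inr (.inr (.inr 0))) + b 2 • .proj (.inr (.inr (.inr 1))) + (b 1 + b 3) •
          .proj (.inl ())] fun x hx => ?_
    have h0 := hx 0
    have h1 := hx 1
    simp at h0 h1
    simp +decide [Fintype.sum_sum_type, Fin.sum_univ_succ, adjMatrix_iso, hA1, hA1', hA2, hA2',
      hA3, hA3', hB1, hB1', hB2, hB2', hB3, hB3']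
    linarith [triangle_form_nonpos pA1 pA2 pA3 h0, triangle_form_nonpos pB1 pB2 pB3 h1]
  -- One edge from each cycle, with no edges between the two, gives a diagonal 2 × 2 block.
  · refine W.two_le_posIndex (u₁ := φ (.inr (.inl 0))) (u₂ := φ (.inr (.inr (.inr 0)))) (v₁ := φ
      (.inr (.inl 1))) (v₂ := φ (.inr (.inr (.inr 1)))) (fun h => ?_) ?_
    · revert h; simp only [φ.map_adj_iff]; decide
    · simp +decide [adjMatrix_iso, hA1, hA1', hA2, hA2', hA3, hA3', hB1, hB1', hB2, hB2', hB3,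
        hB3', pA2.ne', pB2.ne']

theorem posIndex_infty_three_two_three {a b c : ℕ → ℝ} (h : W.IsInfty 3 2 3 a b c) :
    W.posIndex = 2 ↔ 4 * a 1 * a 3 * b 1 * b 3 - a 2 * b 2 * c 1 ^ 2 ≥ 0 := by
  obtain ⟨φ, hA, hB, hC⟩ := h
  obtain ⟨pA1, hA1, hA1'⟩ := EdgeWeight.mk φ (.inl ()) (.inr (.inl 0))
    (hA 1 (by simp) (by simp)) (by decide)
  obtain ⟨pA2, hA2, hA2'⟩ := EdgeWeight.mk φ (.inr (.inl 0)) (.inr (.inl 1))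
    (hA 2 (by simp) (by simp)) (by decide)
  obtain ⟨pA3, hA3, hA3'⟩ := EdgeWeight.mk φ (.inr (.inl 1)) (.inl ())
    (hA 3 (by simp) (by simp)) (by decide)
  obtain ⟨pB1, hB1, hB1'⟩ := EdgeWeight.mk φ (.inr (.inr (.inl 0))) (.inr (.inr (.inr 0)))
    (hB 1 (by simp) (by simp)) (by decide)
  obtain ⟨pB2, hB2, hB2'⟩ := EdgeWeight.mk φ (.inr (.inr (.inr 0))) (.inr (.inr (.inr 1)))
    (hB 2 (by simp) (by simp)) (by decide)
  obtain ⟨pB3, hB3, hB3'⟩ := EdgeWeight.mk φ (.inr (.inr (.inr 1))) (.inr (.inr (.inl 0)))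
    (hB 3 (by simp) (by simp)) (by decide)
  obtain ⟨pC1, hC1, hC1'⟩ := EdgeWeight.mk φ (.inl ()) (.inr (.inr (.inl 0)))
    (hC 1 (by simp) (by simp)) (by decide)
  constructor
  · intro h
    by_contra hlt
    rw [ge_iff_le, not_le] at hlt
    suffices 3 ≤ W.posIndex by omega
    -- Each far edge gives a positive vector. On their orthogonal complement the joined vertices
    -- span a binary form with discriminant as in `hlt`; the third vector is where the completed
    -- square vanishes.
    refine W.le_posIndex_of_orthogonal ![
      Pi.single (φ (.inr (.inl 0))) (1) + Pi.single (φ (.inr (.inl 1))) (1),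
      Pi.single (φ (.inr (.inr (.inr 0)))) (1) + Pi.single (φ (.inr (.inr (.inr 1)))) (1),
      Pi.single (φ (.inl ())) (c 1 * a 2 * b 2) + Pi.single (φ (.inr (.inr (.inl 0)))) (2 * a 1 *
        a 3 * b 2) + Pi.single (φ (.inr (.inl 0))) (-a 3 * c 1 * b 2) + Pi.single (φ (.inr (.inl
        1))) (-a 1 * c 1 * b 2) + Pi.single (φ (.inr (.inr (.inr 0)))) (-2 * b 3 * a 1 * a 3) +
        Pi.single (φ (.inr (.inr (.inr 1)))) (-2 * b 1 * a 1 * a 3)] ?_ ?_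
    · intro i j hij
      fin_cases i <;> fin_cases j <;> first
        | exact absurd rfl hij
        | (simp +decide [mulVec_add, add_dotProduct, dotProduct_add, single_form, -dotProduct_single,
            -single_dotProduct, -mulVec_single, adjMatrix_iso, hA1, hA1', hA2, hA2', hA3, hA3', hB1, hB1', hB2, hB2', hB3, hB3', hC1, hC1']
           try ring)
    · have key : 0 < 2 * (a 1 * a 3 * b 2) * (a 2 * b 2 * c 1 ^ 2 - 4 * a 1 * a 3 * b 1 * b 3) :=
        mul_pos (by positivity) (by linarith)
      intro i
      fin_cases i <;> simp +decide [mulVec_add, add_dotProduct, dotProduct_add, single_form,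
        -dotProduct_single, -single_dotProduct, -mulVec_single, adjMatrix_iso, hA1, hA1', hA2, hA2', hA3, hA3', hB1, hB1', hB2, hB2', hB3, hB3', hC1, hC1']
      · linarith
      · linarith
      · linarith
  · intro hc
    apply le_antisymm
    · refine posIndex_le_of_iso φ ![
          a 2 • .proj (.inr (.inl 0)) + a 2 • .proj (.inr (.inl 1)) + (a 1 + a 3) • .proj (.inl
            ()),
          b 2 • .proj (.inr (.inr (.inr 0))) + b 2 • .proj (.inr (.inr (.inr 1))) + (b 1 + b 3) •
            .proj (.inr (.inr (.inl 0)))] fun x hx => ?_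
      have h0 := hx 0
      have h1 := hx 1
      simp at h0 h1
      simp +decide [Fintype.sum_sum_type, Fin.sum_univ_succ, adjMatrix_iso, hA1, hA1', hA2, hA2',
        hA3, hA3', hB1, hB1', hB2, hB2', hB3, hB3', hC1, hC1']
      linarith [barbell_form_nonpos pA1 pA2 pA3 pB2 hc h0 h1]
    · refine W.two_le_posIndex (u₁ := φ (.inr (.inl 0))) (u₂ := φ (.inr (.inr (.inr 0)))) (v₁ := φ
        (.inr (.inl 1))) (v₂ := φ (.inr (.inr (.inr 1)))) (fun h => ?_) ?_
      · revert h; simp only [φ.map_adj_iff]; decide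
      · simp +decide [adjMatrix_iso, hA1, hA1', hA2, hA2', hA3, hA3', hB1, hB1', hB2, hB2', hB3,
          hB3', hC1, hC1', pA2.ne', pB2.ne']

theorem posIndex_infty_three_one_four {a b c : ℕ → ℝ} (h : W.IsInfty 3 1 4 a b c) :
    W.posIndex = 2 ↔ b 1 * b 3 = b 2 * b 4 := by
  obtain ⟨φ, hA, hB, -⟩ := h
  obtain ⟨pA1, hA1, hA1'⟩ := EdgeWeight.mk φ (.inl ()) (.inr (.inl 0))
    (hA 1 (by simp) (by simp)) (by decide)
  obtain ⟨pA2, hA2, hA2'⟩ := EdgeWeight.mk φ (.inr (.inl 0)) (.inr (.inl 1))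
    (hA 2 (by simp) (by simp)) (by decide)
  obtain ⟨pA3, hA3, hA3'⟩ := EdgeWeight.mk φ (.inr (.inl 1)) (.inl ())
    (hA 3 (by simp) (by simp)) (by decide)
  obtain ⟨pB1, hB1, hB1'⟩ := EdgeWeight.mk φ (.inl ()) (.inr (.inr (.inr 0)))
    (hB 1 (by simp) (by simp)) (by decide)
  obtain ⟨pB2, hB2, hB2'⟩ := EdgeWeight.mk φ (.inr (.inr (.inr 0))) (.inr (.inr (.inr 1)))
    (hB 2 (by simp) (by simp)) (by decide)
  obtain ⟨pB3, hB3, hB3'⟩ := EdgeWeight.mk φ (.inr (.inr (.inr 1))) (.inr (.inr (.inr 2)))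
    (hB 3 (by simp) (by simp)) (by decide)
  obtain ⟨pB4, hB4, hB4'⟩ := EdgeWeight.mk φ (.inr (.inr (.inr 2))) (.inl ())
    (hB 4 (by simp) (by simp)) (by decide)
  constructor
  · intro h
    by_contra hne
    suffices 3 ≤ W.posIndex by omega
    -- The minor equals `a 2 * (b 2 * b 4 - b 1 * b 3)`.
    refine W.three_le_posIndex (u₁ := φ (.inr (.inl 0))) (u₂ := φ (.inr (.inr (.inr 0)))) (u₃ := φ
      (.inr (.inr (.inr 2)))) (v₁ := φ (.inr (.inl 1))) (v₂ := φ (.inr (.inr (.inr 1)))) (v₃ := φ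
      (.inl ())) (fun h => ?_) (fun h => ?_) (fun h => ?_) ?_
    · revert h; simp only [φ.map_adj_iff]; decide
    · revert h; simp only [φ.map_adj_iff]; decide
    · revert h; simp only [φ.map_adj_iff]; decide
    · simp +decide [adjMatrix_iso, hA1, hA1', hA2, hA2', hA3, hA3', hB1, hB1', hB2, hB2', hB3,
        hB3', hB4, hB4']
      intro h0
      refine hne (mul_left_cancel₀ pA2.ne' ?_)
      linarith
  · intro hc
    apply le_antisymm
    · refine posIndex_le_of_iso φ ![
          a 2 • .proj (.inr (.inl 0)) + a 2 • .proj (.inr (.inl 1)) + (a 1 + a 3) • .proj (.inl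
            ()),
          (b 2 * b 2) • .proj (.inr (.inr (.inr 0))) + (b 2 * b 3) • .proj (.inr (.inr (.inr 2)))
            + b 2 • .proj (.inr (.inr (.inr 1))) + b 1 • .proj (.inl ())] fun x hx => ?_
      have h0 := hx 0
      have h1 := hx 1
      simp at h0 h1
      simp +decide [Fintype.sum_sum_type, Fin.sum_univ_succ, adjMatrix_iso, hA1, hA1', hA2, hA2',
        hA3, hA3', hB1, hB1', hB2, hB2', hB3, hB3', hB4, hB4']
      linarith [triangle_form_nonpos pA1 pA2 pA3 h0, square_form_nonpos pB2 hc h1]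
    · refine W.two_le_posIndex (u₁ := φ (.inr (.inl 0))) (u₂ := φ (.inr (.inr (.inr 0)))) (v₁ := φ
        (.inr (.inl 1))) (v₂ := φ (.inr (.inr (.inr 1)))) (fun h => ?_) ?_
      · revert h; simp only [φ.map_adj_iff]; decide
      · simp +decide [adjMatrix_iso, hA1, hA1', hA2, hA2', hA3, hA3', hB1, hB1', hB2, hB2', hB3,
          hB3', hB4, hB4', pA2.ne', pB2.ne']

theorem posIndex_infty_four_one_four {a b c : ℕ → ℝ} (h : W.IsInfty 4 1 4 a b c) :
    W.posIndex = 2 ↔ a 1 * a 3 = a 2 * a 4 ∧ b 1 * b 3 = b 2 * b 4 := by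
  obtain ⟨φ, hA, hB, -⟩ := h
  obtain ⟨pA1, hA1, hA1'⟩ := EdgeWeight.mk φ (.inl ()) (.inr (.inl 0))
    (hA 1 (by simp) (by simp)) (by decide)
  obtain ⟨pA2, hA2, hA2'⟩ := EdgeWeight.mk φ (.inr (.inl 0)) (.inr (.inl 1))
    (hA 2 (by simp) (by simp)) (by decide)
  obtain ⟨pA3, hA3, hA3'⟩ := EdgeWeight.mk φ (.inr (.inl 1)) (.inr (.inl 2))
    (hA 3 (by simp) (by simp)) (by decide)
  obtain ⟨pA4, hA4, hA4'⟩ := EdgeWeight.mk φ (.inr (.inl 2)) (.inl ())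
    (hA 4 (by simp) (by simp)) (by decide)
  obtain ⟨pB1, hB1, hB1'⟩ := EdgeWeight.mk φ (.inl ()) (.inr (.inr (.inr 0)))
    (hB 1 (by simp) (by simp)) (by decide)
  obtain ⟨pB2, hB2, hB2'⟩ := EdgeWeight.mk φ (.inr (.inr (.inr 0))) (.inr (.inr (.inr 1)))
    (hB 2 (by simp) (by simp)) (by decide)
  obtain ⟨pB3, hB3, hB3'⟩ := EdgeWeight.mk φ (.inr (.inr (.inr 1))) (.inr (.inr (.inr 2)))
    (hB 3 (by simp) (by simp)) (by decide)
  obtain ⟨pB4, hB4, hB4'⟩ := EdgeWeight.mk φ (.inr (.inr (.inr 2))) (.inl ())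
    (hB 4 (by simp) (by simp)) (by decide)
  constructor
  · intro h
    refine ⟨?_, ?_⟩ <;> by_contra hne <;> refine absurd h (ne_of_gt ?_ : W.posIndex ≠ 2)
    -- The minor equals `b 2 * (a 1 * a 3 - a 2 * a 4)`; the other case exchanges the two cycles.
    · refine W.three_le_posIndex (u₁ := φ (.inr (.inl 0))) (u₂ := φ (.inr (.inl 2))) (u₃ := φ
        (.inr (.inr (.inr 0)))) (v₁ := φ (.inl ())) (v₂ := φ (.inr (.inl 1))) (v₃ := φ (.inr (.inr
        (.inr 1)))) (fun h => ?_) (fun h => ?_) (fun h => ?_) ?_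
      · revert h; simp only [φ.map_adj_iff]; decide
      · revert h; simp only [φ.map_adj_iff]; decide
      · revert h; simp only [φ.map_adj_iff]; decide
      · simp +decide [adjMatrix_iso, hA1, hA1', hA2, hA2', hA3, hA3', hA4, hA4', hB1, hB1', hB2,
          hB2', hB3, hB3', hB4, hB4']
        intro h0
        refine hne (mul_left_cancel₀ pB2.ne' ?_)
        linarith
    · refine W.three_le_posIndex (u₁ := φ (.inr (.inr (.inr 0)))) (u₂ := φ (.inr (.inr (.inr 2))))
        (u₃ := φ (.inr (.inl 0))) (v₁ := φ (.inl ())) (v₂ := φ (.inr (.inr (.inr 1)))) (v₃ := φ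
        (.inr (.inl 1))) (fun h => ?_) (fun h => ?_) (fun h => ?_) ?_
      · revert h; simp only [φ.map_adj_iff]; decide
      · revert h; simp only [φ.map_adj_iff]; decide
      · revert h; simp only [φ.map_adj_iff]; decide
      · simp +decide [adjMatrix_iso, hA1, hA1', hA2, hA2', hA3, hA3', hA4, hA4', hB1, hB1', hB2,
          hB2', hB3, hB3', hB4, hB4']
        intro h0
        refine hne (mul_left_cancel₀ pA2.ne' ?_)
        linarith
  · rintro ⟨hc, hc'⟩
    apply le_antisymm
    · refine posIndex_le_of_iso φ ![
          (a 2 * a 2) • .proj (.inr (.inl 0)) + (a 2 * a 3) • .proj (.inr (.inl 2)) + a 2 • .proj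
            (.inr (.inl 1)) + a 1 • .proj (.inl ()),
          (b 2 * b 2) • .proj (.inr (.inr (.inr 0))) + (b 2 * b 3) • .proj (.inr (.inr (.inr 2)))
            + b 2 • .proj (.inr (.inr (.inr 1))) + b 1 • .proj (.inl ())] fun x hx => ?_
      have h0 := hx 0
      have h1 := hx 1
      simp at h0 h1
      simp +decide [Fintype.sum_sum_type, Fin.sum_univ_succ, adjMatrix_iso, hA1, hA1', hA2, hA2',
        hA3, hA3', hA4, hA4', hB1, hB1', hB2, hB2', hB3, hB3', hB4, hB4']
      linarith [square_form_nonpos pA2 hc h0, square_form_nonpos pB2 hc' h1]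
    · refine W.two_le_posIndex (u₁ := φ (.inr (.inl 0))) (u₂ := φ (.inr (.inr (.inr 0)))) (v₁ := φ
        (.inr (.inl 1))) (v₂ := φ (.inr (.inr (.inr 1)))) (fun h => ?_) ?_
      · revert h; simp only [φ.map_adj_iff]; decide
      · simp +decide [adjMatrix_iso, hA1, hA1', hA2, hA2', hA3, hA3', hA4, hA4', hB1, hB1', hB2,
          hB2', hB3, hB3', hB4, hB4', pA2.ne', pB2.ne']

theorem posIndex_theta_one_one_one {a b c : ℕ → ℝ} (h : W.IsTheta 1 1 1 a b c) :
    W.posIndex = 2 ↔ a 2 * b 1 ≠ a 1 * b 2 ∨ a 2 * c 1 ≠ a 1 * c 2 := by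
  obtain ⟨φ, hA, hB, hC⟩ := h
  obtain ⟨pA1, hA1, hA1'⟩ := EdgeWeight.mk φ (.inl false) (.inr (.inl 0))
    (hA 1 (by simp) (by simp)) (by decide)
  obtain ⟨pA2, hA2, hA2'⟩ := EdgeWeight.mk φ (.inr (.inl 0)) (.inl true)
    (hA 2 (by simp) (by simp)) (by decide)
  obtain ⟨pB1, hB1, hB1'⟩ := EdgeWeight.mk φ (.inl false) (.inr (.inr (.inl 0)))
    (hB 1 (by simp) (by simp)) (by decide)
  obtain ⟨pB2, hB2, hB2'⟩ := EdgeWeight.mk φ (.inr (.inr (.inl 0))) (.inl true)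
    (hB 2 (by simp) (by simp)) (by decide)
  obtain ⟨pC1, hC1, hC1'⟩ := EdgeWeight.mk φ (.inl false) (.inr (.inr (.inr 0)))
    (hC 1 (by simp) (by simp)) (by decide)
  obtain ⟨pC2, hC2, hC2'⟩ := EdgeWeight.mk φ (.inr (.inr (.inr 0))) (.inl true)
    (hC 2 (by simp) (by simp)) (by decide)
  constructor
  · intro h
    by_contra! hne
    obtain ⟨e₁, e₂⟩ := hne
    suffices W.posIndex ≤ 1 by omega
    refine posIndex_le_of_iso φ ![
        a 1 • .proj (.inr (.inl 0)) + b 1 • .proj (.inr (.inr (.inl 0))) + c 1 • .proj (.inr (.inr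
          (.inr 0))) + a 1 • .proj (.inl false) + a 2 • .proj (.inl true)] fun x hx => ?_
    have h0 := hx 0
    simp at h0
    simp +decide [Fintype.sum_sum_type, Fin.sum_univ_succ, adjMatrix_iso, hA1, hA1', hA2, hA2',
      hB1, hB1', hB2, hB2', hC1, hC1', hC2, hC2']
    linarith [theta_one_one_one_form_nonpos pA1 e₁ e₂ h0]
  · intro hc
    apply le_antisymm
    -- Removing the two ends leaves an independent set, on which the form is zero.
    · refine posIndex_le_of_iso φ ![
          .proj (.inl false),
          .proj (.inl true)] fun x hx => ?_
      have h0 := hx 0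
      have h1 := hx 1
      simp at h0 h1
      simp +decide [Fintype.sum_sum_type, Fin.sum_univ_succ, adjMatrix_iso, hA1, hA1', hA2, hA2',
        hB1, hB1', hB2, hB2', hC1, hC1', hC2, hC2']
      simp [h0, h1]
    · rcases hc with hc | hc
      · refine W.two_le_posIndex (u₁ := φ (.inr (.inl 0))) (u₂ := φ (.inr (.inr (.inl 0)))) (v₁ :=
          φ (.inl false)) (v₂ := φ (.inl true)) (fun h => ?_) ?_
        · revert h; simp only [φ.map_adj_iff]; decide
        · simp +decide [adjMatrix_iso, hA1, hA1', hA2, hA2', hB1, hB1', hB2, hB2', hC1, hC1', hC2,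
            hC2']
          intro h0
          exact hc (by linarith)
      · refine W.two_le_posIndex (u₁ := φ (.inr (.inl 0))) (u₂ := φ (.inr (.inr (.inr 0)))) (v₁ :=
          φ (.inl false)) (v₂ := φ (.inl true)) (fun h => ?_) ?_
        · revert h; simp only [φ.map_adj_iff]; decide
        · simp +decide [adjMatrix_iso, hA1, hA1', hA2, hA2', hB1, hB1', hB2, hB2', hC1, hC1', hC2,
            hC2']
          intro h0
          exact hc (by linarith)

theorem posIndex_theta_one_zero_one {a b c : ℕ → ℝ} (h : W.IsTheta 1 0 1 a b c) :
    W.posIndex = 2 ↔ a 2 * c 1 ≠ a 1 * c 2 := by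
  obtain ⟨φ, hA, hB, hC⟩ := h
  obtain ⟨pA1, hA1, hA1'⟩ := EdgeWeight.mk φ (.inl false) (.inr (.inl 0))
    (hA 1 (by simp) (by simp)) (by decide)
  obtain ⟨pA2, hA2, hA2'⟩ := EdgeWeight.mk φ (.inr (.inl 0)) (.inl true)
    (hA 2 (by simp) (by simp)) (by decide)
  obtain ⟨pB1, hB1, hB1'⟩ := EdgeWeight.mk φ (.inl false) (.inl true)
    (hB 1 (by simp) (by simp)) (by decide)
  obtain ⟨pC1, hC1, hC1'⟩ := EdgeWeight.mk φ (.inl false) (.inr (.inr (.inr 0)))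
    (hC 1 (by simp) (by simp)) (by decide)
  obtain ⟨pC2, hC2, hC2'⟩ := EdgeWeight.mk φ (.inr (.inr (.inr 0))) (.inl true)
    (hC 2 (by simp) (by simp)) (by decide)
  constructor
  · intro h e
    suffices W.posIndex ≤ 1 by omega
    refine posIndex_le_of_iso φ ![
        (b 1 * a 1) • .proj (.inl false) + b 1 • .proj (.inl true) + ((1 + a 2) * a 1) • .proj
          (.inr (.inl 0)) + ((1 + a 2) * c 1) • .proj (.inr (.inr (.inr 0)))] fun x hx => ?_
    have h0 := hx 0
    simp at h0
    simp +decide [Fintype.sum_sum_type, Fin.sum_univ_succ, adjMatrix_iso, hA1, hA1', hA2, hA2',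
      hB1, hB1', hC1, hC1', hC2, hC2']
    linarith [theta_one_zero_one_form_nonpos pA1 pA2 pB1 e (by linarith : b 1 * a 1 * x (.inl false) + b 1 * x (.inl true) + (1 + a 2) * (a 1 * x (.inr (.inl 0)) + c 1 * x (.inr (.inr (.inr 0)))) = 0)]
  · intro hc
    apply le_antisymm
    · refine posIndex_le_of_iso φ ![
          .proj (.inl false),
          .proj (.inl true)] fun x hx => ?_
      have h0 := hx 0
      have h1 := hx 1
      simp at h0 h1
      simp +decide [Fintype.sum_sum_type, Fin.sum_univ_succ, adjMatrix_iso, hA1, hA1', hA2, hA2',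
        hB1, hB1', hC1, hC1', hC2, hC2']
      simp [h0, h1]
    · refine W.two_le_posIndex (u₁ := φ (.inr (.inl 0))) (u₂ := φ (.inr (.inr (.inr 0)))) (v₁ := φ
        (.inl false)) (v₂ := φ (.inl true)) (fun h => ?_) ?_
      · revert h; simp only [φ.map_adj_iff]; decide
      · simp +decide [adjMatrix_iso, hA1, hA1', hA2, hA2', hB1, hB1', hC1, hC1', hC2, hC2']
        intro h0
        exact hc (by linarith)

theorem posIndex_theta_one_zero_two {a b c : ℕ → ℝ} (h : W.IsTheta 1 0 2 a b c) :
    W.posIndex = 2 ↔ b 1 * c 2 ≥ c 1 * c 3 := by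
  obtain ⟨φ, hA, hB, hC⟩ := h
  obtain ⟨pA1, hA1, hA1'⟩ := EdgeWeight.mk φ (.inl false) (.inr (.inl 0))
    (hA 1 (by simp) (by simp)) (by decide)
  obtain ⟨pA2, hA2, hA2'⟩ := EdgeWeight.mk φ (.inr (.inl 0)) (.inl true)
    (hA 2 (by simp) (by simp)) (by decide)
  obtain ⟨pB1, hB1, hB1'⟩ := EdgeWeight.mk φ (.inl false) (.inl true)
    (hB 1 (by simp) (by simp)) (by decide)
  obtain ⟨pC1, hC1, hC1'⟩ := EdgeWeight.mk φ (.inl false) (.inr (.inr (.inr 0)))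
    (hC 1 (by simp) (by simp)) (by decide)
  obtain ⟨pC2, hC2, hC2'⟩ := EdgeWeight.mk φ (.inr (.inr (.inr 0))) (.inr (.inr (.inr 1)))
    (hC 2 (by simp) (by simp)) (by decide)
  obtain ⟨pC3, hC3, hC3'⟩ := EdgeWeight.mk φ (.inr (.inr (.inr 1))) (.inl true)
    (hC 3 (by simp) (by simp)) (by decide)
  constructor
  · intro h
    by_contra! hlt
    suffices 3 ≤ W.posIndex by omega
    -- The graph is a pentagon with a chord between the two ends, and `hlt` is the inequality needed
    -- there.
    apply W.three_le_posIndex_of_pentagon (s := φ (.inl false)) (x := φ (.inr (.inl 0)))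
      (t := φ (.inl true)) (z := φ (.inr (.inr (.inr 1)))) (y := φ (.inr (.inr (.inr 0))))
    case hlt => simpa +decide [adjMatrix_iso, hA1, hA1', hA2, hA2', hB1, hB1', hC1, hC1', hC2, hC2', hC3, hC3'] using hlt
    all_goals simp only [φ.map_adj_iff]; decide
  · intro hc
    apply le_antisymm
    · refine posIndex_le_of_iso φ ![
          c 2 • .proj (.inr (.inr (.inr 0))) + c 3 • .proj (.inl true) + c 2 • .proj (.inr (.inr
            (.inr 1))) + c 1 • .proj (.inl false),
          a 1 • .proj (.inl false) + a 2 • .proj (.inl true)] fun x hx => ?_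
      have h0 := hx 0
      have h1 := hx 1
      simp at h0 h1
      simp +decide [Fintype.sum_sum_type, Fin.sum_univ_succ, adjMatrix_iso, hA1, hA1', hA2, hA2',
        hB1, hB1', hC1, hC1', hC2, hC2', hC3, hC3']
      linarith [theta_one_zero_two_form_nonpos (x := x (.inr (.inl 0))) pA1 pA2 pC2 hc h0 h1]
    · refine W.two_le_posIndex (u₁ := φ (.inr (.inl 0))) (u₂ := φ (.inr (.inr (.inr 1)))) (v₁ := φ
        (.inl false)) (v₂ := φ (.inr (.inr (.inr 0)))) (fun h => ?_) ?_
      · revert h; simp only [φ.map_adj_iff]; decide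
      · simp +decide [adjMatrix_iso, hA1, hA1', hA2, hA2', hB1, hB1', hC1, hC1', hC2, hC2', hC3,
          hC3', pA1.ne', pC2.ne']

theorem posIndex_theta_two_zero_two {a b c : ℕ → ℝ} (h : W.IsTheta 2 0 2 a b c) :
    W.posIndex = 2 ↔ a 2 * b 1 * c 2 = a 1 * a 3 * c 2 + a 2 * c 1 * c 3 := by
  obtain ⟨φ, hA, hB, hC⟩ := h
  obtain ⟨pA1, hA1, hA1'⟩ := EdgeWeight.mk φ (.inl false) (.inr (.inl 0))
    (hA 1 (by simp) (by simp)) (by decide)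
  obtain ⟨pA2, hA2, hA2'⟩ := EdgeWeight.mk φ (.inr (.inl 0)) (.inr (.inl 1))
    (hA 2 (by simp) (by simp)) (by decide)
  obtain ⟨pA3, hA3, hA3'⟩ := EdgeWeight.mk φ (.inr (.inl 1)) (.inl true)
    (hA 3 (by simp) (by simp)) (by decide)
  obtain ⟨pB1, hB1, hB1'⟩ := EdgeWeight.mk φ (.inl false) (.inl true)
    (hB 1 (by simp) (by simp)) (by decide)
  obtain ⟨pC1, hC1, hC1'⟩ := EdgeWeight.mk φ (.inl false) (.inr (.inr (.inr 0)))
    (hC 1 (by simp) (by simp)) (by decide)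
  obtain ⟨pC2, hC2, hC2'⟩ := EdgeWeight.mk φ (.inr (.inr (.inr 0))) (.inr (.inr (.inr 1)))
    (hC 2 (by simp) (by simp)) (by decide)
  obtain ⟨pC3, hC3, hC3'⟩ := EdgeWeight.mk φ (.inr (.inr (.inr 1))) (.inl true)
    (hC 3 (by simp) (by simp)) (by decide)
  constructor
  · intro h
    by_contra hne
    suffices 3 ≤ W.posIndex by omega
    -- The graph is bipartite, and the determinant of its 3 × 3 block is the difference of the two
    -- sides of the condition.
    refine W.three_le_posIndex (u₁ := φ (.inl false)) (u₂ := φ (.inr (.inl 1))) (u₃ := φ (.inr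
      (.inr (.inr 1)))) (v₁ := φ (.inl true)) (v₂ := φ (.inr (.inl 0))) (v₃ := φ (.inr (.inr (.inr
      0)))) (fun h => ?_) (fun h => ?_) (fun h => ?_) ?_
    · revert h; simp only [φ.map_adj_iff]; decide
    · revert h; simp only [φ.map_adj_iff]; decide
    · revert h; simp only [φ.map_adj_iff]; decide
    · simp +decide [adjMatrix_iso, hA1, hA1', hA2, hA2', hA3, hA3', hB1, hB1', hC1, hC1', hC2,
        hC2', hC3, hC3']
      intro h0
      exact hne (by linarith)
  · intro hc
    apply le_antisymm
    · refine posIndex_le_of_iso φ ![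
          (a 2 * a 3) • .proj (.inl true) + (a 2 * a 2) • .proj (.inr (.inl 0)) + a 2 • .proj
            (.inr (.inl 1)) + a 1 • .proj (.inl false),
          (c 2 * c 3) • .proj (.inl true) + (c 2 * c 2) • .proj (.inr (.inr (.inr 0))) + c 2 •
            .proj (.inr (.inr (.inr 1))) + c 1 • .proj (.inl false)] fun x hx => ?_
      have h0 := hx 0
      have h1 := hx 1
      simp at h0 h1
      simp +decide [Fintype.sum_sum_type, Fin.sum_univ_succ, adjMatrix_iso, hA1, hA1', hA2, hA2',
        hA3, hA3', hB1, hB1', hC1, hC1', hC2, hC2', hC3, hC3']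
      linarith [theta_two_zero_two_form_nonpos pA2 pC2 hc h0 h1]
    · refine W.two_le_posIndex (u₁ := φ (.inr (.inl 1))) (u₂ := φ (.inr (.inr (.inr 1)))) (v₁ := φ
        (.inr (.inl 0))) (v₂ := φ (.inr (.inr (.inr 0)))) (fun h => ?_) ?_
      · revert h; simp only [φ.map_adj_iff]; decide
      · simp +decide [adjMatrix_iso, hA1, hA1', hA2, hA2', hA3, hA3', hB1, hB1', hC1, hC1', hC2,
          hC2', hC3, hC3', pA2.ne', pC2.ne']

end WeightedGraph

/-! ### Neighbourhoods, local isomorphisms and degrees -/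

namespace SimpleGraph

variable {V : Type*} {G : SimpleGraph V}

/-- The neighbours of `x` are the two distinct vertices `p` and `q`. -/
def NbrTwo (G : SimpleGraph V) (x p q : V) : Prop :=
  q ≠ p ∧ p ≠ x ∧ q ≠ x ∧ G.Adj x p ∧ G.Adj p x ∧ G.Adj x q ∧ G.Adj q x ∧
    (∀ w, G.Adj x w ↔ w = p ∨ w = q) ∧ ∀ w, G.Adj w x ↔ w = p ∨ w = q

/-- The neighbours of `x` are the three distinct vertices `p`, `q` and `r`. -/
def NbrThree (G : SimpleGraph V) (x p q r : V) : Prop :=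
  q ≠ p ∧ r ≠ p ∧ q ≠ r ∧ p ≠ x ∧ q ≠ x ∧ r ≠ x ∧ G.Adj x p ∧ G.Adj p x ∧ G.Adj x q ∧ G.Adj q x ∧
    G.Adj x r ∧ G.Adj r x ∧ (∀ w, G.Adj x w ↔ w = p ∨ w = q ∨ w = r) ∧
      ∀ w, G.Adj w x ↔ w = p ∨ w = q ∨ w = r

/-- The neighbours of `x` are the four distinct vertices `p`, `q`, `r` and `s`. -/
def NbrFour (G : SimpleGraph V) (x p q r s : V) : Prop :=
  p ≠ q ∧ r ≠ p ∧ r ≠ q ∧ s ≠ p ∧ s ≠ q ∧ r ≠ s ∧ p ≠ x ∧ q ≠ x ∧ r ≠ x ∧ s ≠ x ∧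
    G.Adj x p ∧ G.Adj p x ∧ G.Adj x q ∧ G.Adj q x ∧ G.Adj x r ∧ G.Adj r x ∧ G.Adj x s ∧ G.Adj s x ∧
      (∀ w, G.Adj x w ↔ w = p ∨ w = q ∨ w = r ∨ w = s) ∧
        ∀ w, G.Adj w x ↔ w = p ∨ w = q ∨ w = r ∨ w = s

theorem exists_nbrTwo {x p : V} (h : (G.neighborSet x).ncard = 2)
    (hp : G.Adj x p) : ∃ q, G.NbrTwo x p q := by
  obtain ⟨a, b, hab, hS⟩ := Set.ncard_eq_two.1 h
  have key : ∀ w, G.Adj x w ↔ w = a ∨ w = b := fun w => by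
    rw [← mem_neighborSet, hS]; simp
  have hs : ∀ w, G.Adj w x ↔ G.Adj x w := fun w => G.adj_comm w x
  have hi := G.irrefl (v := x)
  rcases (key p).1 hp with rfl | rfl
  · exact ⟨b, by grind [NbrTwo]⟩
  · exact ⟨a, by grind [NbrTwo]⟩

/-- An injective map of a nonempty graph into a connected graph that induces bijections on
neighbourhoods is an isomorphism. -/
theorem nonempty_iso_of_local_iso {α : Type*} [Nonempty α] {H : SimpleGraph α} (hG : G.Connected)
    (f : α → V) (hinj : Function.Injective f) (hom : ∀ i j, H.Adj i j → G.Adj (f i) (f j))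
    (hclosed : ∀ i w, G.Adj (f i) w → ∃ j, H.Adj i j ∧ f j = w) : Nonempty (H ≃g G) := by
  have hsurj : Function.Surjective f := by
    intro w
    obtain ⟨i⟩ := ‹Nonempty α›
    obtain ⟨p⟩ := hG.preconnected (f i) w
    -- The image of `f` is closed under adjacency, so by connectedness it is everything.
    have : ∀ (a b : V) (_ : G.Walk a b), (∃ i, f i = a) → ∃ i, f i = b := by
      intro a b p
      induction p with
      | nil => exact id
      | cons h _ ih =>
        rintro ⟨i, rfl⟩
        obtain ⟨j, -, hj⟩ := hclosed i _ h
        exact ih ⟨j, hj⟩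
    exact this _ _ p ⟨i, rfl⟩
  refine ⟨⟨Equiv.ofBijective f ⟨hinj, hsurj⟩, ?_⟩⟩
  intro i j
  refine ⟨fun h => ?_, hom i j⟩
  obtain ⟨k, hk, e⟩ := hclosed i _ h
  rwa [← hinj e]

theorem exists_nbrThree {x p : V} (h : (G.neighborSet x).ncard = 3)
    (hp : G.Adj x p) : ∃ q r, G.NbrThree x p q r := by
  have h' : (G.neighborSet x \ {p}).ncard = 2 := by
    rw [Set.ncard_sdiff_singleton_of_mem (by simpa using hp), h]
  obtain ⟨a, b, hab, hS⟩ := Set.ncard_eq_two.1 h'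
  have key : ∀ w, (G.Adj x w ∧ w ≠ p) ↔ w = a ∨ w = b := fun w => by
    rw [← mem_neighborSet]; simpa using Set.ext_iff.1 hS w
  have hs : ∀ w, G.Adj w x ↔ G.Adj x w := fun w => G.adj_comm w x
  have hi := G.irrefl (v := x)
  exact ⟨a, b, by grind [NbrThree]⟩

theorem exists_nbrFour {x p q : V} (h : (G.neighborSet x).ncard = 4)
    (hp : G.Adj x p) (hq : G.Adj x q) (hpq : p ≠ q) : ∃ r s, G.NbrFour x p q r s := by
  have h' : ((G.neighborSet x \ {p}) \ {q}).ncard = 2 := by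
    rw [Set.ncard_sdiff_singleton_of_mem (by simp [hq, hpq.symm]),
      Set.ncard_sdiff_singleton_of_mem (by simpa using hp), h]
  obtain ⟨a, b, hab, hS⟩ := Set.ncard_eq_two.1 h'
  have key : ∀ w, ((G.Adj x w ∧ w ≠ p) ∧ w ≠ q) ↔ w = a ∨ w = b := fun w => by
    rw [← mem_neighborSet]; simpa using Set.ext_iff.1 hS w
  have hs : ∀ w, G.Adj w x ↔ G.Adj x w := fun w => G.adj_comm w x
  have hi := G.irrefl (v := x)
  exact ⟨a, b, by grind [NbrFour]⟩

/-- A connected graph without pendant vertices which has one more edge than vertices has a single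
vertex of degree four or two vertices of degree three, and its other vertices have degree two. -/
theorem degrees_of_isBicyclic [Finite V] (h : IsBicyclic G) (hp : ∀ v, ¬ IsPendant G v) :
    (∃ v, (G.neighborSet v).ncard = 4 ∧ ∀ x ≠ v, (G.neighborSet x).ncard = 2) ∨
    ∃ s t, s ≠ t ∧ (G.neighborSet s).ncard = 3 ∧ (G.neighborSet t).ncard = 3 ∧
      ∀ x, x ≠ s → x ≠ t → (G.neighborSet x).ncard = 2 := by
  classical
  have := Fintype.ofFinite V
  have hdeg : ∀ v, (G.neighborSet v).ncard = G.degree v := fun v => by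
    rw [← card_neighborSet_eq_degree, Set.ncard_eq_toFinset_card', Set.toFinset_card]
  have hsum := G.sum_degrees_eq_twice_card_edges
  have hE : G.edgeFinset.card = Fintype.card V + 1 := by
    rw [← Nat.card_eq_fintype_card, ← h.2, Set.ncard_eq_toFinset_card', edgeFinset]
  have hnt : Nontrivial V := by
    by_contra hn
    rw [not_nontrivial_iff_subsingleton] at hn
    have : G.edgeFinset.card = 0 := by
      rw [Finset.card_eq_zero, Finset.eq_empty_iff_forall_notMem]
      intro e
      induction e with
      | _ a b => simp [Subsingleton.elim a b]
    omega
  have hmin : ∀ v, 2 ≤ G.degree v := fun v => by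
    have h1 := hp v
    rw [IsPendant, hdeg] at h1
    have := h.1.preconnected.degree_pos_of_nontrivial v
    omega
  -- By the handshake lemma the excess is `2(n + 1) - 2n`; truncated subtraction is harmless because
  -- of `hmin`. It sits at one vertex or is shared by two.
  have hsum2 : ∑ v, (G.degree v - 2) = 2 := by
    have h3 : ∑ v, G.degree v = ∑ v, (G.degree v - 2) + ∑ _v : V, 2 := by
      rw [← Finset.sum_add_distrib]
      exact Finset.sum_congr rfl fun v _ => (Nat.sub_add_cancel (hmin v)).symm
    simp at h3
    omega
  simp only [hdeg]
  obtain ⟨v, -, hv⟩ := Finset.exists_ne_zero_of_sum_ne_zero (s := Finset.univ)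
    (f := fun v => G.degree v - 2) (by rw [hsum2]; simp)
  rw [← Finset.add_sum_erase _ _ (Finset.mem_univ v)] at hsum2
  by_cases h0 : ∑ x ∈ Finset.univ.erase v, (G.degree x - 2) = 0
  · refine Or.inl ⟨v, by have := hmin v; omega, fun x hx => ?_⟩
    have := Finset.sum_eq_zero_iff.1 h0 x (by simp [hx])
    have := hmin x
    omega
  · obtain ⟨t, ht, ht0⟩ := Finset.exists_ne_zero_of_sum_ne_zero h0
    rw [← Finset.add_sum_erase _ _ ht] at hsum2
    have h0' : ∑ x ∈ (Finset.univ.erase v).erase t, (G.degree x - 2) = 0 := by omega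
    refine Or.inr ⟨v, t, (Finset.ne_of_mem_erase ht).symm, by omega, by omega, fun x hx hxt => ?_⟩
    have := Finset.sum_eq_zero_iff.1 h0' x (by simp [hx, hxt])
    have := hmin x
    omega

end SimpleGraph

/-! ### Cycles through a vertex of degree four -/

namespace WeightedGraph

variable {V : Type*} [Fintype V] [DecidableEq V] {W : WeightedGraph V}

open SimpleGraph

/-- The cycles through the vertex of degree four have length three or four. -/
theorem short_cycle_of_degree_four {v n : V} (hle : W.posIndex ≤ 2)
    (hv : (W.graph.neighborSet v).ncard = 4)
    (h2 : ∀ x ≠ v, (W.graph.neighborSet x).ncard = 2) (hn : W.graph.Adj v n) :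
    (∃ m, W.graph.Adj v m ∧ W.graph.NbrTwo n v m) ∨
    ∃ m k, ¬ W.graph.Adj v m ∧ m ≠ v ∧ W.graph.Adj v k ∧
      W.graph.NbrTwo n v m ∧ W.graph.NbrTwo m n k := by
  obtain ⟨m, hN⟩ := exists_nbrTwo (h2 n hn.ne') hn.symm
  by_cases hvm : W.graph.Adj v m
  · exact Or.inl ⟨m, hvm, hN⟩
  have hmv : m ≠ v := by grind [NbrTwo]
  obtain ⟨k, hM⟩ := exists_nbrTwo (h2 m hmv) (p := n) (by grind [NbrTwo])
  by_cases hvk : W.graph.Adj v k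
  · exact Or.inr ⟨m, k, hvm, hmv, hvk, hN, hM⟩
  have hkv : k ≠ v := by grind [NbrTwo]
  obtain ⟨j, hK⟩ := exists_nbrTwo (h2 k hkv) (p := m) (by grind [NbrTwo])
  -- On the long walk `v n m k j`, a neighbour `r` of `v` away from `j` completes the ordered
  -- matching `km`, `nv`, `rm'`. Only `n` and at most one further neighbour of `v` need avoiding.
  obtain ⟨r, hr, hrn, hrj, hrj'⟩ :
      ∃ r, W.graph.Adj v r ∧ r ≠ n ∧ r ≠ j ∧ ¬ W.graph.Adj j r := by
    by_cases hvj : W.graph.Adj v j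
    · obtain ⟨r, s, h⟩ := exists_nbrFour hv hn hvj (by grind [NbrTwo])
      obtain ⟨l, hJ⟩ := exists_nbrTwo (h2 j hvj.ne') hvj.symm
      exact ⟨r, by grind [NbrTwo, NbrFour]⟩
    · have hjv : j ≠ v := by grind [NbrTwo]
      obtain ⟨l, hJ⟩ := exists_nbrTwo (h2 j hjv) (p := k) (by grind [NbrTwo])
      obtain ⟨r, hr, hrn⟩ := Set.exists_ne_of_one_lt_ncard (s := W.graph.neighborSet v)
        (by omega) n
      obtain ⟨r', s, h⟩ := exists_nbrFour hv hn hr hrn.symm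
      by_cases hl' : l = r
      · exact ⟨r', by grind [NbrTwo, NbrFour]⟩
      · exact ⟨r, by grind [NbrTwo, NbrFour]⟩
  obtain ⟨m', hR⟩ := exists_nbrTwo (h2 r hr.ne') hr.symm
  have := W.three_le_posIndex_of_triangular (u₁ := k) (u₂ := n) (u₃ := r) (v₁ := m) (v₂ := v)
    (v₃ := m') (by grind [NbrTwo]) (by grind [NbrTwo]) (by grind [NbrTwo]) (by grind [NbrTwo])
    (by grind [NbrTwo]) (by grind [NbrTwo]) (by grind [NbrTwo])
    (by grind [NbrTwo]) (by grind [NbrTwo])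
  omega

end WeightedGraph

/-! ### Recognising the models from their neighbourhoods -/

namespace SimpleGraph

variable {V : Type*} {G : SimpleGraph V}

/-- A form of the local criterion that `simp` can unfold over the finitely many vertices of a model.
-/
theorem nonempty_iso_of_nbrs {α : Type*} [Nonempty α] {H : SimpleGraph α} (hG : G.Connected)
    (f : α → V) (hinj : ∀ i j, f i = f j → i = j)
    (h : ∀ i w, G.Adj (f i) w ↔ ∃ j, H.Adj i j ∧ f j = w) : Nonempty (H ≃g G) :=
  nonempty_iso_of_local_iso hG f hinj (fun i j hij => (h i _).2 ⟨j, hij, rfl⟩)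
    fun i w hw => (h i w).1 hw

theorem nonempty_iso_infty_three_one_three (hG : G.Connected) {v x₁ x₂ y₁ y₂ : V} (hv : G.NbrFour
    v x₁ x₂ y₁ y₂) (hx₁ : G.NbrTwo x₁ v x₂) (hx₂ : G.NbrTwo x₂ v x₁) (hy₁ : G.NbrTwo y₁ v y₂) (hy₂
    : G.NbrTwo y₂ v y₁) : Nonempty (inftyGraph 3 1 3 ≃g G) := by
  refine nonempty_iso_of_nbrs hG
    (Sum.elim (fun _ => v) (Sum.elim ![x₁, x₂] (Sum.elim ![] ![y₁, y₂]))) ?_ ?_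
  · simp [Fin.forall_fin_succ]
    grind [NbrTwo, NbrThree, NbrFour]
  · simp +decide [Fin.forall_fin_succ, Fin.exists_fin_succ, Unique.forall_iff]
    grind [NbrTwo, NbrThree, NbrFour]

theorem nonempty_iso_infty_three_two_three (hG : G.Connected) {v u x₁ x₂ y₁ y₂ : V} (hv :
    G.NbrThree v u x₁ x₂) (hu : G.NbrThree u v y₁ y₂) (hx₁ : G.NbrTwo x₁ v x₂) (hx₂ : G.NbrTwo x₂
    v x₁) (hy₁ : G.NbrTwo y₁ u y₂) (hy₂ : G.NbrTwo y₂ u y₁) : Nonempty (inftyGraph 3 2 3 ≃g G) :=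
    by
  refine nonempty_iso_of_nbrs hG
    (Sum.elim (fun _ => v) (Sum.elim ![x₁, x₂] (Sum.elim ![u] ![y₁, y₂]))) ?_ ?_
  · simp [Fin.forall_fin_succ]
    grind [NbrTwo, NbrThree, NbrFour]
  · simp +decide [Fin.forall_fin_succ, Fin.exists_fin_succ, Unique.forall_iff]
    grind [NbrTwo, NbrThree, NbrFour]

theorem nonempty_iso_infty_three_one_four (hG : G.Connected) {v x₁ x₂ y₁ y₂ y₃ : V} (hv :
    G.NbrFour v x₁ x₂ y₁ y₃) (hx₁ : G.NbrTwo x₁ v x₂) (hx₂ : G.NbrTwo x₂ v x₁) (hy₁ : G.NbrTwo y₁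
    v y₂) (hy₂ : G.NbrTwo y₂ y₁ y₃) (hy₃ : G.NbrTwo y₃ v y₂) (hvy : ¬ G.Adj v y₂) : Nonempty
    (inftyGraph 3 1 4 ≃g G) := by
  refine nonempty_iso_of_nbrs hG
    (Sum.elim (fun _ => v) (Sum.elim ![x₁, x₂] (Sum.elim ![] ![y₁, y₂, y₃]))) ?_ ?_
  · simp [Fin.forall_fin_succ]
    grind [NbrTwo, NbrThree, NbrFour]
  · simp +decide [Fin.forall_fin_succ, Fin.exists_fin_succ, Unique.forall_iff]
    grind [NbrTwo, NbrThree, NbrFour]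

theorem nonempty_iso_infty_four_one_four (hG : G.Connected) {v x₁ x₂ x₃ y₁ y₂ y₃ : V} (hv :
    G.NbrFour v x₁ x₃ y₁ y₃) (hx₁ : G.NbrTwo x₁ v x₂) (hx₂ : G.NbrTwo x₂ x₁ x₃) (hx₃ : G.NbrTwo x₃
    v x₂) (hvx : ¬ G.Adj v x₂) (hy₁ : G.NbrTwo y₁ v y₂) (hy₂ : G.NbrTwo y₂ y₁ y₃) (hy₃ : G.NbrTwo
    y₃ v y₂) (hvy : ¬ G.Adj v y₂) : Nonempty (inftyGraph 4 1 4 ≃g G) := by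
  refine nonempty_iso_of_nbrs hG
    (Sum.elim (fun _ => v) (Sum.elim ![x₁, x₂, x₃] (Sum.elim ![] ![y₁, y₂, y₃]))) ?_ ?_
  · simp [Fin.forall_fin_succ]
    grind [NbrTwo, NbrThree, NbrFour]
  · simp +decide [Fin.forall_fin_succ, Fin.exists_fin_succ, Unique.forall_iff]
    grind [NbrTwo, NbrThree, NbrFour]

theorem nonempty_iso_theta_one_one_one (hG : G.Connected) {s t x y z : V} (hst : s ≠ t) (hs :
    G.NbrThree s x y z) (ht : G.NbrThree t x y z) (hx : G.NbrTwo x s t) (hy : G.NbrTwo y s t) (hz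
    : G.NbrTwo z s t) : Nonempty (thetaGraph 1 1 1 ≃g G) := by
  refine nonempty_iso_of_nbrs hG
    (Sum.elim (fun b => if b then t else s) (Sum.elim ![x] (Sum.elim ![y] ![z]))) ?_ ?_
  · simp [Fin.forall_fin_succ]
    grind [NbrTwo, NbrThree, NbrFour]
  · simp +decide [Fin.forall_fin_succ, Fin.exists_fin_succ, Unique.forall_iff]
    grind [NbrTwo, NbrThree, NbrFour]

theorem nonempty_iso_theta_one_zero_one (hG : G.Connected) {s t x y : V} (hs : G.NbrThree s t x y)
    (ht : G.NbrThree t s x y) (hx : G.NbrTwo x s t) (hy : G.NbrTwo y s t) : Nonempty (thetaGraph 1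
    0 1 ≃g G) := by
  refine nonempty_iso_of_nbrs hG
    (Sum.elim (fun b => if b then t else s) (Sum.elim ![x] (Sum.elim ![] ![y]))) ?_ ?_
  · simp [Fin.forall_fin_succ]
    grind [NbrTwo, NbrThree, NbrFour]
  · simp +decide [Fin.forall_fin_succ, Fin.exists_fin_succ, Unique.forall_iff]
    grind [NbrTwo, NbrThree, NbrFour]

theorem nonempty_iso_theta_one_zero_two (hG : G.Connected) {s t x y₁ y₂ : V} (hs : G.NbrThree s t
    x y₁) (ht : G.NbrThree t s x y₂) (hx : G.NbrTwo x s t) (hy₁ : G.NbrTwo y₁ s y₂) (hy₂ :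
    G.NbrTwo y₂ y₁ t) : Nonempty (thetaGraph 1 0 2 ≃g G) := by
  refine nonempty_iso_of_nbrs hG
    (Sum.elim (fun b => if b then t else s) (Sum.elim ![x] (Sum.elim ![] ![y₁, y₂]))) ?_ ?_
  · simp [Fin.forall_fin_succ]
    grind [NbrTwo, NbrThree, NbrFour]
  · simp +decide [Fin.forall_fin_succ, Fin.exists_fin_succ, Unique.forall_iff]
    grind [NbrTwo, NbrThree, NbrFour]

theorem nonempty_iso_theta_two_zero_two (hG : G.Connected) {s t x₁ x₂ y₁ y₂ : V} (hs : G.NbrThree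
    s t x₁ y₁) (ht : G.NbrThree t s x₂ y₂) (hx₁ : G.NbrTwo x₁ s x₂) (hx₂ : G.NbrTwo x₂ x₁ t) (hy₁
    : G.NbrTwo y₁ s y₂) (hy₂ : G.NbrTwo y₂ y₁ t) : Nonempty (thetaGraph 2 0 2 ≃g G) := by
  refine nonempty_iso_of_nbrs hG
    (Sum.elim (fun b => if b then t else s) (Sum.elim ![x₁, x₂] (Sum.elim ![] ![y₁, y₂]))) ?_ ?_
  · simp [Fin.forall_fin_succ]
    grind [NbrTwo, NbrThree, NbrFour]
  · simp +decide [Fin.forall_fin_succ, Fin.exists_fin_succ, Unique.forall_iff]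
    grind [NbrTwo, NbrThree, NbrFour]

end SimpleGraph

namespace SimpleGraph

variable {V : Type*} {G : SimpleGraph V}

theorem nbrTwo_of_adj {x p q : V} (h : (G.neighborSet x).ncard = 2) (hp : G.Adj x p)
    (hq : G.Adj x q) (hpq : p ≠ q) : G.NbrTwo x p q := by
  obtain ⟨r, hr⟩ := exists_nbrTwo h hp
  grind [NbrTwo]

theorem exists_nbrThree_of_adj_of_adj {x p q : V} (h : (G.neighborSet x).ncard = 3)
    (hp : G.Adj x p) (hq : G.Adj x q) (hpq : p ≠ q) : ∃ r, G.NbrThree x p q r := by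
  obtain ⟨a, b, hab⟩ := exists_nbrThree h hp
  by_cases hqa : q = a
  · exact ⟨b, by grind [NbrThree]⟩
  · exact ⟨a, by grind [NbrThree]⟩

theorem nbrThree_of_adj {x p q r : V} (h : (G.neighborSet x).ncard = 3) (hp : G.Adj x p)
    (hq : G.Adj x q) (hr : G.Adj x r) (hpq : p ≠ q) (hpr : p ≠ r) (hqr : q ≠ r) :
    G.NbrThree x p q r := by
  obtain ⟨a, ha⟩ := exists_nbrThree_of_adj_of_adj h hp hq hpq
  grind [NbrThree]

theorem exists_adj_ne_ne {x : V} (h : 2 < (G.neighborSet x).ncard) (p q : V) :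
    ∃ r, G.Adj x r ∧ r ≠ p ∧ r ≠ q := by
  obtain ⟨r, hr, hr'⟩ := Set.exists_mem_notMem_of_ncard_lt_ncard
    (s := ({p, q} : Set V)) (t := G.neighborSet x) (lt_of_le_of_lt ((Set.ncard_insert_le p {q}).trans (by simp)) h)
  exact ⟨r, hr, by simpa [not_or] using hr'⟩

end SimpleGraph

/-! ### Classification of the graphs with index at most two -/

namespace WeightedGraph

variable {V : Type*} [Fintype V] [DecidableEq V] {W : WeightedGraph V}

open SimpleGraph

/-- Every neighbour of `v` lies on a triangle or 4-cycle through `v`, so the four neighbours split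
into two pairs. -/
theorem classification_of_degree_four {v : V} (hle : W.posIndex ≤ 2) (hG : W.graph.Connected)
    (hv : (W.graph.neighborSet v).ncard = 4)
    (h2 : ∀ x ≠ v, (W.graph.neighborSet x).ncard = 2) :
    Nonempty (inftyGraph 3 1 3 ≃g W.graph) ∨ Nonempty (inftyGraph 3 1 4 ≃g W.graph) ∨
      Nonempty (inftyGraph 4 1 4 ≃g W.graph) := by
  have hcyc : ∀ n, W.graph.Adj v n →
      (∃ m, W.graph.NbrTwo n v m ∧ W.graph.NbrTwo m v n) ∨
      ∃ m k, ¬ W.graph.Adj v m ∧ W.graph.NbrTwo n v m ∧ W.graph.NbrTwo m n k ∧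
        W.graph.NbrTwo k v m := by
    intro n hn
    rcases short_cycle_of_degree_four hle hv h2 hn with ⟨m, hm, hN⟩ | ⟨m, k, hm, hmv, hk, hN, hM⟩
    · exact Or.inl ⟨m, hN, nbrTwo_of_adj (h2 m hm.ne') hm.symm (by grind [NbrTwo]) hn.ne⟩
    · exact Or.inr ⟨m, k, hm, hN, hM,
        nbrTwo_of_adj (h2 k hk.ne') hk.symm (by grind [NbrTwo]) hmv.symm⟩
  obtain ⟨n, hn, -⟩ := exists_adj_ne_ne (x := v) (G := W.graph) (by omega) v v
  rcases hcyc n hn with ⟨p, hN, hP⟩ | ⟨m, p, hm, hN, hM, hP⟩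
  · obtain ⟨r, r', hR⟩ := exists_nbrFour hv hn (by grind [NbrTwo] : W.graph.Adj v p)
      (by grind [NbrTwo])
    rcases hcyc r (by grind [NbrFour]) with ⟨q, hA, hB⟩ | ⟨k, q, hk, hA, hK, hB⟩
    · obtain rfl : q = r' := by grind [NbrTwo, NbrFour]
      exact Or.inl (nonempty_iso_infty_three_one_three hG hR hN hP hA hB)
    · obtain rfl : q = r' := by grind [NbrTwo, NbrFour]
      exact Or.inr (Or.inl (nonempty_iso_infty_three_one_four hG hR hN hP hA hK hB hk))
  · obtain ⟨r, r', hR⟩ := exists_nbrFour hv hn (by grind [NbrTwo] : W.graph.Adj v p)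
      (by grind [NbrTwo])
    rcases hcyc r (by grind [NbrFour]) with ⟨q, hA, hB⟩ | ⟨k, q, hk, hA, hK, hB⟩
    · obtain rfl : q = r' := by grind [NbrTwo, NbrFour]
      have hR' : W.graph.NbrFour v r q n p := by grind [NbrFour]
      exact Or.inr (Or.inl (nonempty_iso_infty_three_one_four hG hR' hA hB hN hM hP hm))
    · obtain rfl : q = r' := by grind [NbrTwo, NbrFour]
      exact Or.inr (Or.inr (nonempty_iso_infty_four_one_four hG hR hN hM hP hm hA hK hB hk))

/-- The threads from one of two non-adjacent vertices of degree three. -/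
theorem thread_of_not_adj {s t x : V} (hle : W.posIndex ≤ 2) (hst : s ≠ t)
    (hnst : ¬ W.graph.Adj s t)
    (hs : (W.graph.neighborSet s).ncard = 3) (ht : (W.graph.neighborSet t).ncard = 3)
    (h2 : ∀ x, x ≠ s → x ≠ t → (W.graph.neighborSet x).ncard = 2) (hx : W.graph.Adj s x) :
    W.graph.Adj x t ∨
      ∃ y, ¬ W.graph.Adj s y ∧ W.graph.NbrTwo x s y ∧ W.graph.NbrTwo y x t := by
  by_contra! hcon
  obtain ⟨hxt, hcon⟩ := hcon
  have hnts : ¬ W.graph.Adj t s := fun h => hnst h.symm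
  have hxt' : x ≠ t := by rintro rfl; exact hnst hx
  suffices 3 ≤ W.posIndex by omega
  obtain ⟨y, hX⟩ := exists_nbrTwo (h2 x hx.ne' hxt') hx.symm
  have hyt : y ≠ t := by grind [NbrTwo]
  have hys : y ≠ s := by grind [NbrTwo]
  -- an edge at `t` away from the neighbour `x'` of `s`
  have far : ∀ x', W.graph.Adj s x' → ∃ y' z z', W.graph.NbrTwo x' s y' ∧ W.graph.NbrTwo z t z' ∧
      z ≠ x' ∧ z ≠ y' ∧ z ≠ s := by
    intro x' hx'
    have hx't : x' ≠ t := by rintro rfl; exact hnst hx'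
    obtain ⟨y', hX'⟩ := exists_nbrTwo (h2 x' hx'.ne' hx't) hx'.symm
    obtain ⟨z, hz, hzx, hzy⟩ := exists_adj_ne_ne (x := t) (G := W.graph) (by omega) x' y'
    have hzs : z ≠ s := by rintro rfl; exact hnts hz
    obtain ⟨z', hZ⟩ := exists_nbrTwo (h2 z hzs hz.ne') hz.symm
    exact ⟨y', z, z', hX', hZ, hzx, hzy, hzs⟩
  -- A triangle or a 4-cycle closing up at `s` contains an edge avoiding `s`; it joins the edge from
  -- `s` to its third neighbour and the far edge at `t` in an ordered matching.
  by_cases hsy : W.graph.Adj s y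
  · have hY := nbrTwo_of_adj (h2 y hys hyt) hsy.symm (by grind [NbrTwo]) hx.ne
    obtain ⟨x', hS⟩ := exists_nbrThree_of_adj_of_adj hs hx hsy (by grind [NbrTwo])
    obtain ⟨y', z, z', hX', hZ, hzx, hzy, hzs⟩ := far x' (by grind [NbrThree])
    apply W.three_le_posIndex_of_triangular (u₁ := z) (u₂ := x') (u₃ := x) (v₁ := t) (v₂ := s)
      (v₃ := y) <;> grind [NbrTwo, NbrThree]
  obtain ⟨w, hY⟩ := exists_nbrTwo (h2 y hys hyt) (p := x) (by grind [NbrTwo])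
  have hwt : w ≠ t := by rintro rfl; exact hcon y hsy hX hY
  have hws : w ≠ s := by grind [NbrTwo]
  by_cases hsw : W.graph.Adj s w
  · have hW := nbrTwo_of_adj (h2 w hws hwt) hsw.symm (by grind [NbrTwo]) hys.symm
    obtain ⟨x', hS⟩ := exists_nbrThree_of_adj_of_adj hs hx hsw (by grind [NbrTwo])
    obtain ⟨y', z, z', hX', hZ, hzx, hzy, hzs⟩ := far x' (by grind [NbrThree])
    apply W.three_le_posIndex_of_triangular (u₁ := z) (u₂ := x') (u₃ := y) (v₁ := t) (v₂ := s)
      (v₃ := x) <;> grind [NbrTwo, NbrThree]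
  obtain ⟨u, hW⟩ := exists_nbrTwo (h2 w hws hwt) (p := y) (by grind [NbrTwo])
  obtain ⟨x₂, x₃, hS⟩ := exists_nbrThree hs hx
  -- Another neighbour of `s` away from `u` completes the matching `wy`, `xs`, `x'y'`. Escaping this
  -- requires both remaining neighbours of `s` to be adjacent to `u`, which then has degree three
  -- and is `t`; an induced hexagon results.
  have hd : ∀ x', W.graph.Adj s x' → x' ≠ x → x' ≠ u → ¬ W.graph.Adj x' u → 3 ≤ W.posIndex := by
    intro x' hx' hne hxu hadj
    have hx't : x' ≠ t := by rintro rfl; exact hnst hx'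
    obtain ⟨y', hX'⟩ := exists_nbrTwo (h2 x' hx'.ne' hx't) hx'.symm
    apply W.three_le_posIndex_of_triangular (u₁ := w) (u₂ := x) (u₃ := x') (v₁ := y) (v₂ := s)
      (v₃ := y') <;> grind [NbrTwo]
  have hx₂t : x₂ ≠ t := by grind [NbrThree]
  have hx₃t : x₃ ≠ t := by grind [NbrThree]
  obtain ⟨y₂, hX₂⟩ := exists_nbrTwo (h2 x₂ (by grind [NbrThree]) hx₂t) (p := s)
    (by grind [NbrThree])
  obtain ⟨y₃, hX₃⟩ := exists_nbrTwo (h2 x₃ (by grind [NbrThree]) hx₃t) (p := s)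
    (by grind [NbrThree])
  have hd₂ := hd x₂ (by grind [NbrThree]) (by grind [NbrThree])
  have hd₃ := hd x₃ (by grind [NbrThree]) (by grind [NbrThree])
  by_cases hux₂ : x₂ = u
  · exact hd₃ (by grind [NbrThree]) (by grind [NbrTwo, NbrThree])
  by_cases hux₃ : x₃ = u
  · exact hd₂ (by grind [NbrThree]) (by grind [NbrTwo, NbrThree])
  by_cases hau₂ : W.graph.Adj x₂ u
  swap
  · exact hd₂ hux₂ hau₂
  by_cases hau₃ : W.graph.Adj x₃ u
  swap
  · exact hd₃ hux₃ hau₃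
  obtain rfl : u = t := by
    by_contra hut
    have hus : u ≠ s := by grind [NbrTwo]
    obtain ⟨u', hU⟩ := exists_nbrTwo (h2 u hus hut) (p := w) (by grind [NbrTwo])
    grind [NbrTwo, NbrThree]
  apply W.three_le_posIndex_of_hexagon (u₁ := x) (u₂ := w) (u₃ := x₂) (v₁ := s) (v₂ := y)
      (v₃ := u) <;> grind [NbrTwo, NbrThree]

/-- A thread with two inner vertices cannot occur: with a thread with one inner vertex it bounds an
induced pentagon, and three such threads have a matching of middle edges. -/
theorem classification_of_not_adj {s t : V} (hle : W.posIndex ≤ 2) (hG : W.graph.Connected)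
    (hst : s ≠ t) (hnst : ¬ W.graph.Adj s t)
    (hs : (W.graph.neighborSet s).ncard = 3) (ht : (W.graph.neighborSet t).ncard = 3)
    (h2 : ∀ x, x ≠ s → x ≠ t → (W.graph.neighborSet x).ncard = 2) :
    Nonempty (thetaGraph 1 1 1 ≃g W.graph) := by
  have hth := fun x => thread_of_not_adj (x := x) hle hst hnst hs ht h2
  have hnts : ¬ W.graph.Adj t s := fun h => hnst h.symm
  have hsub : ∀ x, W.graph.Adj s x → W.graph.Adj x t := by
    intro x hx
    by_contra hxt
    suffices 3 ≤ W.posIndex by omega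
    obtain ⟨y, hsy, hX, hY⟩ := (hth x hx).resolve_left hxt
    have hpent : ∀ x', W.graph.Adj s x' → W.graph.Adj x' t → 3 ≤ W.posIndex := by
      intro x' hx' hx't
      have hX' := nbrTwo_of_adj (h2 x' hx'.ne' hx't.ne) hx'.symm hx't hst
      apply W.three_le_posIndex_of_pentagon (s := s) (x := x') (t := t) (z := y) (y := x)
      case hlt =>
        rw [W.adjMatrix_eq_zero hnst, zero_mul]
        exact mul_pos (W.adjMatrix_pos hx) (W.adjMatrix_pos (by grind [NbrTwo]))
      all_goals grind [NbrTwo]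
    obtain ⟨x₂, x₃, hS⟩ := exists_nbrThree hs hx
    rcases hth x₂ (by grind [NbrThree]) with h | ⟨y₂, hsy₂, hX₂, hY₂⟩
    · exact hpent x₂ (by grind [NbrThree]) h
    rcases hth x₃ (by grind [NbrThree]) with h | ⟨y₃, hsy₃, hX₃, hY₃⟩
    · exact hpent x₃ (by grind [NbrThree]) h
    apply W.three_le_posIndex_of_triangular (u₁ := x) (u₂ := x₂) (u₃ := x₃) (v₁ := y) (v₂ := y₂)
      (v₃ := y₃) <;> grind [NbrTwo, NbrThree]
  have hN : ∀ x, W.graph.Adj s x → W.graph.NbrTwo x s t := fun x hx =>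
    nbrTwo_of_adj (h2 x hx.ne' (hsub x hx).ne) hx.symm (hsub x hx) hst
  obtain ⟨x, hx, -⟩ := exists_adj_ne_ne (x := s) (G := W.graph) (by omega) s s
  obtain ⟨y, z, hS⟩ := exists_nbrThree hs hx
  have hX := hN x hx
  have hY := hN y (by grind [NbrThree])
  have hZ := hN z (by grind [NbrThree])
  have hT : W.graph.NbrThree t x y z := by
    apply nbrThree_of_adj ht <;> grind [NbrTwo, NbrThree]
  exact nonempty_iso_theta_one_one_one hG hst hS hT hX hY hZ

/-- The threads from one of two adjacent vertices of degree three. -/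
theorem thread_of_adj {s t x : V} (hle : W.posIndex ≤ 2) (hst : W.graph.Adj s t)
    (hs : (W.graph.neighborSet s).ncard = 3) (ht : (W.graph.neighborSet t).ncard = 3)
    (h2 : ∀ x, x ≠ s → x ≠ t → (W.graph.neighborSet x).ncard = 2) (hx : W.graph.Adj s x)
    (hxt : x ≠ t) :
    W.graph.Adj x t ∨ (∃ y, W.graph.Adj s y ∧ y ≠ t ∧ W.graph.NbrTwo x s y) ∨
      ∃ y, ¬ W.graph.Adj s y ∧ W.graph.NbrTwo x s y ∧ W.graph.NbrTwo y x t := by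
  by_contra! hcon
  obtain ⟨hxt', hcon, hcon'⟩ := hcon
  suffices 3 ≤ W.posIndex by omega
  have hts := hst.symm
  obtain ⟨y, hX⟩ := exists_nbrTwo (h2 x hx.ne' hxt) hx.symm
  have hyt : y ≠ t := by grind [NbrTwo]
  have hys : y ≠ s := by grind [NbrTwo]
  have hsy : ¬ W.graph.Adj s y := fun h => hcon y h hyt hX
  obtain ⟨w, hY⟩ := exists_nbrTwo (h2 y hys hyt) (p := x) (by grind [NbrTwo])
  have hwt : w ≠ t := by rintro rfl; exact hcon' y hsy hX hY
  have hws : w ≠ s := by grind [NbrTwo]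
  -- The thread `s x y w` either closes into a 4-cycle at `s`, reaches `t` and closes an induced
  -- pentagon with `st`, or goes on; the first and last cases give ordered matchings.
  by_cases hsw : W.graph.Adj s w
  · have hW := nbrTwo_of_adj (h2 w hws hwt) hsw.symm (by grind [NbrTwo]) hys.symm
    have hS := nbrThree_of_adj hs hst hx hsw hxt.symm hwt.symm (by grind [NbrTwo])
    obtain ⟨z, hz, hzs, -⟩ := exists_adj_ne_ne (x := t) (G := W.graph) (by omega) s s
    obtain ⟨z', hZ⟩ := exists_nbrTwo (h2 z hzs hz.ne') hz.symm
    apply W.three_le_posIndex_of_triangular (u₁ := y) (u₂ := s) (u₃ := z) (v₁ := x) (v₂ := t)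
      (v₃ := z') <;> grind [NbrTwo, NbrThree]
  by_cases hwt' : W.graph.Adj w t
  · have hsy' : W.adjMatrix s y = 0 := W.adjMatrix_eq_zero hsy
    apply W.three_le_posIndex_of_pentagon (s := s) (x := x) (t := y) (z := w) (y := t)
    case hlt =>
      rw [hsy', zero_mul]
      exact mul_pos (W.adjMatrix_pos hst) (W.adjMatrix_pos (by grind [NbrTwo]))
    all_goals grind [NbrTwo]
  · obtain ⟨u, hW⟩ := exists_nbrTwo (h2 w hws hwt) (p := y) (by grind [NbrTwo])
    obtain ⟨z, hz, hzs, hzu⟩ := exists_adj_ne_ne (x := t) (G := W.graph) (by omega) s u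
    obtain ⟨z', hZ⟩ := exists_nbrTwo (h2 z hzs hz.ne') hz.symm
    apply W.three_le_posIndex_of_triangular (u₁ := w) (u₂ := x) (u₃ := t) (v₁ := y) (v₂ := s)
      (v₃ := z) <;> grind [NbrTwo]

/-- If the other two neighbours of `s` are adjacent, they form a triangle with `s`, and the threads
from `t` must close up too. Otherwise both threads end at `t`, with one or two inner vertices each.
-/
theorem classification_of_adj {s t : V} (hle : W.posIndex ≤ 2) (hG : W.graph.Connected)
    (hst : W.graph.Adj s t)
    (hs : (W.graph.neighborSet s).ncard = 3) (ht : (W.graph.neighborSet t).ncard = 3)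
    (h2 : ∀ x, x ≠ s → x ≠ t → (W.graph.neighborSet x).ncard = 2) :
    Nonempty (inftyGraph 3 2 3 ≃g W.graph) ∨ Nonempty (thetaGraph 1 0 1 ≃g W.graph) ∨
      Nonempty (thetaGraph 1 0 2 ≃g W.graph) ∨ Nonempty (thetaGraph 2 0 2 ≃g W.graph) := by
  have hne := hst.ne
  have hsx := fun x => thread_of_adj (x := x) hle hst hs ht h2
  have htx := fun x => thread_of_adj (x := x) hle hst.symm ht hs fun x h h' => h2 x h' h
  obtain ⟨x₁, x₂, hS⟩ := exists_nbrThree hs hst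
  have hx₁ : W.graph.Adj s x₁ := by grind [NbrThree]
  have hx₂ : W.graph.Adj s x₂ := by grind [NbrThree]
  have hx₁t : x₁ ≠ t := by grind [NbrThree]
  have hx₂t : x₂ ≠ t := by grind [NbrThree]
  by_cases hx : W.graph.Adj x₁ x₂
  · have hX₁ := nbrTwo_of_adj (h2 x₁ hx₁.ne' hx₁t) hx₁.symm hx hx₂.ne
    have hX₂ := nbrTwo_of_adj (h2 x₂ hx₂.ne' hx₂t) hx₂.symm hx.symm hx₁.ne
    obtain ⟨z₁, z₂, hT⟩ := exists_nbrThree ht hst.symm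
    have hz₁ : W.graph.Adj t z₁ := by grind [NbrThree]
    have hz₂ : W.graph.Adj t z₂ := by grind [NbrThree]
    have hz₁s : z₁ ≠ s := by grind [NbrThree]
    have hz₂s : z₂ ≠ s := by grind [NbrThree]
    have hZ₁ : W.graph.NbrTwo z₁ t z₂ := by
      rcases htx z₁ hz₁ hz₁s with h | ⟨y, hy, hys, hZ⟩ | ⟨y, hy, hZ, hY⟩
      · grind [NbrTwo, NbrThree]
      · obtain rfl : y = z₂ := by grind [NbrTwo, NbrThree]
        exact hZ
      · grind [NbrTwo, NbrThree]
    have hZ₂ := nbrTwo_of_adj (h2 z₂ hz₂s hz₂.ne') hz₂.symm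
      (by grind [NbrTwo] : W.graph.Adj z₂ z₁) hz₁.ne
    exact Or.inl (nonempty_iso_infty_three_two_three hG hS hT hX₁ hX₂ hZ₁ hZ₂)
  · refine Or.inr ?_
    have hx' : ∀ x, W.graph.Adj s x → x ≠ t → W.graph.NbrTwo x s t ∨
        ∃ y, ¬ W.graph.Adj s y ∧ W.graph.NbrTwo x s y ∧ W.graph.NbrTwo y x t := by
      intro x hx hxt
      rcases hsx x hx hxt with h | ⟨y, hy, hyt, hX⟩ | h
      · exact Or.inl (nbrTwo_of_adj (h2 x hx.ne' hxt) hx.symm h hne)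
      · grind [NbrTwo, NbrThree]
      · exact Or.inr h
    rcases hx' x₁ hx₁ hx₁t with hX₁ | ⟨y₁, hy₁, hX₁, hY₁⟩ <;>
      rcases hx' x₂ hx₂ hx₂t with hX₂ | ⟨y₂, hy₂, hX₂, hY₂⟩
    · have hT : W.graph.NbrThree t s x₁ x₂ := by
        apply nbrThree_of_adj ht <;> grind [NbrTwo, NbrThree]
      exact Or.inl (nonempty_iso_theta_one_zero_one hG hS hT hX₁ hX₂)
    · have hT : W.graph.NbrThree t s x₁ y₂ := by
        apply nbrThree_of_adj ht <;> grind [NbrTwo, NbrThree]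
      exact Or.inr (Or.inl (nonempty_iso_theta_one_zero_two hG hS hT hX₁ hX₂ hY₂))
    · have hT : W.graph.NbrThree t s x₂ y₁ := by
        apply nbrThree_of_adj ht <;> grind [NbrTwo, NbrThree]
      have hS' : W.graph.NbrThree s t x₂ x₁ := by grind [NbrThree]
      exact Or.inr (Or.inl (nonempty_iso_theta_one_zero_two hG hS' hT hX₂ hX₁ hY₁))
    · have hT : W.graph.NbrThree t s y₁ y₂ := by
        apply nbrThree_of_adj ht <;> grind [NbrTwo, NbrThree]
      exact Or.inr (Or.inr (nonempty_iso_theta_two_zero_two hG hS hT hX₁ hY₁ hX₂ hY₂))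

end WeightedGraph

/-! ### Conclusion -/

namespace WeightedGraph

/-- The weights are read off along `φ`, so an isomorphism of the underlying graphs is enough. -/
theorem exists_isInfty {V : Type*} (W : WeightedGraph V) {p l q : ℕ}
    (φ : inftyGraph p l q ≃g W.graph) : ∃ a b c, W.IsInfty p l q a b c :=
  ⟨_, _, _, φ, fun _ _ _ => rfl, fun _ _ _ => rfl, fun _ _ _ => rfl⟩

theorem exists_isTheta {V : Type*} (W : WeightedGraph V) {p l q : ℕ}
    (φ : thetaGraph p l q ≃g W.graph) : ∃ a b c, W.IsTheta p l q a b c :=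
  ⟨_, _, _, φ, fun _ _ _ => rfl, fun _ _ _ => rfl, fun _ _ _ => rfl⟩

end WeightedGraph

theorem theorem4p3 {V : Type*} [Fintype V] [DecidableEq V] (W : WeightedGraph V)
    (hbicyclic : IsBicyclic W.graph) (hpendant : ∀ v, ¬ IsPendant W.graph v) :
    (W.posIndex = 2 ↔
      (∃ a b c, W.IsInfty 3 1 3 a b c) ∨
      (∃ a b c, W.IsInfty 3 2 3 a b c ∧
        4 * a 1 * a 3 * b 1 * b 3 - a 2 * b 2 * c 1 ^ 2 ≥ 0) ∨
      (∃ a b c, W.IsInfty 3 1 4 a b c ∧ b 1 * b 3 = b 2 * b 4) ∨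
      (∃ a b c, W.IsInfty 4 1 4 a b c ∧ a 1 * a 3 = a 2 * a 4 ∧ b 1 * b 3 = b 2 * b 4) ∨
      (∃ a b c, W.IsTheta 1 1 1 a b c ∧ (a 2 * b 1 ≠ a 1 * b 2 ∨ a 2 * c 1 ≠ a 1 * c 2)) ∨
      (∃ a b c, W.IsTheta 1 0 1 a b c ∧ a 2 * c 1 ≠ a 1 * c 2) ∨
      (∃ a b c, W.IsTheta 1 0 2 a b c ∧ b 1 * c 2 ≥ c 1 * c 3) ∨
      (∃ a b c, W.IsTheta 2 0 2 a b c ∧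
        a 2 * b 1 * c 2 = a 1 * a 3 * c 2 + a 2 * c 1 * c 3)) ∧
    -- The weight conditions do not depend on the choice of the labelling.
    (∀ a b c : ℕ → ℝ,
      (W.IsInfty 3 1 3 a b c → W.posIndex = 2) ∧
      (W.IsInfty 3 2 3 a b c →
        (W.posIndex = 2 ↔ 4 * a 1 * a 3 * b 1 * b 3 - a 2 * b 2 * c 1 ^ 2 ≥ 0)) ∧
      (W.IsInfty 3 1 4 a b c → (W.posIndex = 2 ↔ b 1 * b 3 = b 2 * b 4)) ∧
      (W.IsInfty 4 1 4 a b c →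
        (W.posIndex = 2 ↔ a 1 * a 3 = a 2 * a 4 ∧ b 1 * b 3 = b 2 * b 4)) ∧
      (W.IsTheta 1 1 1 a b c →
        (W.posIndex = 2 ↔ a 2 * b 1 ≠ a 1 * b 2 ∨ a 2 * c 1 ≠ a 1 * c 2)) ∧
      (W.IsTheta 1 0 1 a b c → (W.posIndex = 2 ↔ a 2 * c 1 ≠ a 1 * c 2)) ∧
      (W.IsTheta 1 0 2 a b c → (W.posIndex = 2 ↔ b 1 * c 2 ≥ c 1 * c 3)) ∧
      (W.IsTheta 2 0 2 a b c →
        (W.posIndex = 2 ↔ a 2 * b 1 * c 2 = a 1 * a 3 * c 2 + a 2 * c 1 * c 3))) := by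
  have hG := hbicyclic.1
  refine ⟨⟨fun h => ?_, ?_⟩, fun a b c => ⟨WeightedGraph.posIndex_infty_three_one_three,
    WeightedGraph.posIndex_infty_three_two_three, WeightedGraph.posIndex_infty_three_one_four,
    WeightedGraph.posIndex_infty_four_one_four, WeightedGraph.posIndex_theta_one_one_one,
    WeightedGraph.posIndex_theta_one_zero_one, WeightedGraph.posIndex_theta_one_zero_two,
    WeightedGraph.posIndex_theta_two_zero_two⟩⟩
  · rcases SimpleGraph.degrees_of_isBicyclic hbicyclic hpendant with
      ⟨v, hv, h2⟩ | ⟨s, t, hst, hs, ht, h2⟩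
    · rcases WeightedGraph.classification_of_degree_four h.le hG hv h2 with ⟨⟨φ⟩⟩ | ⟨⟨φ⟩⟩ | ⟨⟨φ⟩⟩
      · obtain ⟨a, b, c, hW⟩ := W.exists_isInfty φ
        exact Or.inl ⟨a, b, c, hW⟩
      · obtain ⟨a, b, c, hW⟩ := W.exists_isInfty φ
        exact Or.inr (Or.inr (Or.inl ⟨a, b, c, hW,
          (WeightedGraph.posIndex_infty_three_one_four hW).1 h⟩))
      · obtain ⟨a, b, c, hW⟩ := W.exists_isInfty φ
        exact Or.inr (Or.inr (Or.inr (Or.inl ⟨a, b, c, hW,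
          (WeightedGraph.posIndex_infty_four_one_four hW).1 h⟩)))
    · by_cases hadj : W.graph.Adj s t
      · rcases WeightedGraph.classification_of_adj h.le hG hadj hs ht h2 with
          ⟨⟨φ⟩⟩ | ⟨⟨φ⟩⟩ | ⟨⟨φ⟩⟩ | ⟨⟨φ⟩⟩
        · obtain ⟨a, b, c, hW⟩ := W.exists_isInfty φ
          exact Or.inr (Or.inl ⟨a, b, c, hW,
            (WeightedGraph.posIndex_infty_three_two_three hW).1 h⟩)
        · obtain ⟨a, b, c, hW⟩ := W.exists_isTheta φ
          exact Or.inr (Or.inr (Or.inr (Or.inr (Or.inr (Or.inl ⟨a, b, c, hW,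
            (WeightedGraph.posIndex_theta_one_zero_one hW).1 h⟩)))))
        · obtain ⟨a, b, c, hW⟩ := W.exists_isTheta φ
          exact Or.inr (Or.inr (Or.inr (Or.inr (Or.inr (Or.inr (Or.inl ⟨a, b, c, hW,
            (WeightedGraph.posIndex_theta_one_zero_two hW).1 h⟩))))))
        · obtain ⟨a, b, c, hW⟩ := W.exists_isTheta φ
          exact Or.inr (Or.inr (Or.inr (Or.inr (Or.inr (Or.inr (Or.inr ⟨a, b, c, hW,
            (WeightedGraph.posIndex_theta_two_zero_two hW).1 h⟩))))))
      · obtain ⟨φ⟩ := WeightedGraph.classification_of_not_adj h.le hG hst hadj hs ht h2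
        obtain ⟨a, b, c, hW⟩ := W.exists_isTheta φ
        exact Or.inr (Or.inr (Or.inr (Or.inr (Or.inl ⟨a, b, c, hW,
          (WeightedGraph.posIndex_theta_one_one_one hW).1 h⟩))))
  · rintro (⟨a, b, c, hW⟩ | ⟨a, b, c, hW, hc⟩ | ⟨a, b, c, hW, hc⟩ | ⟨a, b, c, hW, hc⟩ |
      ⟨a, b, c, hW, hc⟩ | ⟨a, b, c, hW, hc⟩ | ⟨a, b, c, hW, hc⟩ | ⟨a, b, c, hW, hc⟩)
    · exact WeightedGraph.posIndex_infty_three_one_three hW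
    · exact (WeightedGraph.posIndex_infty_three_two_three hW).2 hc
    · exact (WeightedGraph.posIndex_infty_three_one_four hW).2 hc
    · exact (WeightedGraph.posIndex_infty_four_one_four hW).2 hc
    · exact (WeightedGraph.posIndex_theta_one_one_one hW).2 hc
    · exact (WeightedGraph.posIndex_theta_one_zero_one hW).2 hc
    · exact (WeightedGraph.posIndex_theta_one_zero_two hW).2 hc
    · exact (WeightedGraph.posIndex_theta_two_zero_two hW).2 hc
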